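/- Let $\bar n,\bar k,\bar d,u$ be positive integers and $v$ an integer with $0\le v\le u-1$ and $\bar k+1\le\bar d\le\bar n-1$. Put $n=\bar n u$, $k=\bar k u+v$, $\bar s=\bar d-\bar k+1$, $l=\bar s^{\lceil \bar n/(\bar s+1)\rceil}$, and for positive integers $m$ $$\Omega(m,u)=\frac12\sum_{t=1}^{m}\sum_{\delta=t}^{ut}\binom{m-1}{t-1}\binom{ut}{\delta}\binom{\delta-1}{t-1}(\delta-t+1)(\delta+t-2).$$ Let $q$ be a prime power with $u\mid q-1$ and $$q\ \ge\ n\bar s+u\bigl(\Omega(\bar s+1,u)+\bar s\,2^{\bar s-1}\bigr).$$ Then there is an $(n,k,l)$ MDS array code $\mathcal C$ over $\mathbb F_q$, that is, an $\mathbb F_q$-linear subspace of $(\mathbb F_q^l)^n$ of dimension $kl$ in which every codeword $(\mathbf c_0,\dots,\mathbf c_{n-1})$ is determined by any $k$ of its coordinates $\mathbf c_j\in\mathbb F_q^l$, with the following repair properties. The coordinates (nodes) are divided into $\bar n$ consecutive racks of size $u$. The nodes that fail all lie in one rack, the host rack. Each helper rack sends the host rack symbols of $\mathbb F_q$ computed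 from the contents of all of its $u$ nodes, and the host rack recovers its failed nodes from these symbols and from its own surviving nodes. The repair bandwidth is the total number of symbols sent by the helper racks. The cut-set bound for $h$ failed nodes and $\bar d$ helper racks is $\bar d h l/\bar s$, and a repair whose bandwidth is equal to it is called optimal. 1. For every $h\in[1,u-v]$, any $h$ failed nodes in any one rack can be repaired from any $\bar d$ other racks with optimal repair bandwidth $\bar d h l/\bar s$, each helper rack sending $hl/\bar s$ symbols. 2. For every $h\in[u-v+1,u]$, any $h$ failed nodes in any one rack can be repaired from any $\bar d$ other racks together with any one further rack (so this part concerns $\bar d\le\bar n-2$), each of the $\bar d$ racks sending $hl/\bar s$ symbols, with repair bandwidth $$\frac{\bar d h l}{\bar s}+\frac{(h-u+v)l}{\bar s}\ <\ \Bigl(1+\frac1{\bar d}\Bigr)\frac{\bar d h l}{\bar s},$$ which is asymptotically optimal as $\bar d$ grows. -/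

import Mathlib

/-- The quantity
`Ω(m,u) = (1/2) ∑_{t=1}^{m} ∑_{δ=t}^{ut} C(m-1,t-1) C(ut,δ) C(δ-1,t-1) (δ-t+1) (δ+t-2)`.
(All natural-number subtractions below are of the form `x - 1` with `1 ≤ x`.) -/
def Omega (m u : ℕ) : ℚ :=
  (1 / 2 : ℚ) * ∑ t ∈ Finset.Icc 1 m, ∑ δ ∈ Finset.Icc t (u * t),
    ((m - 1).choose (t - 1) : ℚ) * ((u * t).choose δ : ℚ) * ((δ - 1).choose (t - 1) : ℚ)
      * ((δ : ℚ) - (t : ℚ) + 1) * ((δ : ℚ) + (t : ℚ) - 2)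

/-- `C` is an `(n,k)` MDS array code over `F` with sub-packetization `l`: a linear code
of dimension `k * l`, all of whose codewords `(c_0, …, c_{n-1})`, `c_i ∈ F^l`, are determined by
any `k` of their coordinates. -/
def IsMDSArrayCode {F : Type*} [Field F] {n l : ℕ}
    (C : Submodule F (Fin n → Fin l → F)) (k : ℕ) : Prop :=
  Module.finrank F C = k * l ∧
    ∀ S : Finset (Fin n), S.card = k →
      ∀ c ∈ C, ∀ c' ∈ C, (∀ i ∈ S, c i = c' i) → c = c'

/-- The `g`-th node of the `i`-th rack, i.e. the node with index `i * u + g`. -/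
def rackNode {nbar u : ℕ} (i : Fin nbar) (g : Fin u) : Fin (nbar * u) :=
  finProdFinEquiv (i, g)

theorem rackNode_val {nbar u : ℕ} (i : Fin nbar) (g : Fin u) :
    (rackNode i g : ℕ) = i * u + g := by
  simp [rackNode, Nat.mul_comm, Nat.add_comm]

/-- A scheme which repairs, for every codeword of `C`, the failed nodes `(i, g)`, `g ∈ I`, of the
host rack `i` with the help of the racks in `H`: every helper rack `j ∈ H` sends `β j` symbols of
`F`, computed from the contents of all the nodes of rack `j`, and the host rack recovers the failed
nodes from the symbols it receives and from its own surviving nodes. -/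
structure RackRepairScheme {F : Type*} [Field F] {nbar u l : ℕ}
    (C : Submodule F (Fin (nbar * u) → Fin l → F))
    (i : Fin nbar) (I : Finset (Fin u)) (H : Finset (Fin nbar)) where
  /-- the number of symbols downloaded from each rack -/
  β : Fin nbar → ℕ
  /-- what a helper rack sends, as a function of its contents -/
  send : ∀ j : {j : Fin nbar // j ∈ H}, (Fin u → Fin l → F) → (Fin (β j) → F)
  /-- what the host rack computes from the received symbols and its surviving nodes -/
  recover : (∀ j : {j : Fin nbar // j ∈ H}, Fin (β j) → F) →
    ({g : Fin u // g ∉ I} → Fin l → F) → ({g : Fin u // g ∈ I} → Fin l → F)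
  /-- the failed nodes of every codeword are recovered -/
  repairs : ∀ c ∈ C,
    recover (fun j => send j (fun g => c (rackNode j.1 g))) (fun g => c (rackNode i g.1))
      = fun g => c (rackNode i g.1)

/-- The repair bandwidth: the total number of symbols downloaded from the helper racks.
Communication inside a rack is free. -/
def RackRepairScheme.bandwidth {F : Type*} [Field F] {nbar u l : ℕ}
    {C : Submodule F (Fin (nbar * u) → Fin l → F)}
    {i : Fin nbar} {I : Finset (Fin u)} {H : Finset (Fin nbar)}
    (R : RackRepairScheme C i I H) : ℕ :=
  ∑ j ∈ H, R.β j

/-- The cut-set bound `dbar * h * l / sbar`, with `sbar = dbar - kbar + 1`, on the bandwidth of the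
repair of `h` failed nodes of one rack from `dbar` helper racks. A scheme whose bandwidth is equal
to it has optimal repair bandwidth. -/
def cutSetBound (dbar h l sbar : ℕ) : ℚ :=
  (dbar : ℚ) * (h : ℚ) * (l : ℚ) / (sbar : ℚ)

/-! Index the `l` symbols of a node by tuples `x` in `[s]^G`, one tensor factor `F^s` for each group
of at most `s + 1` racks. Node `g` of rack `j` acts on the factor of its group with eigenvalues `ξ^g
λ_{j,i}` and eigenvectors `e_a - e_b`, where `b` is the position of the rack and `a ≠ b`; these form
a basis of the sum-zero hyperplane of `F^{s+1}`. Symbols are stored in eigencoordinates, and the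
code is cut out by the first `n - k` power-sum parity checks of these operators.

MDS property: inside one group, injectivity is the nonvanishing of determinants that are polynomials
in the `λ_{j,i}`. Their degrees in each variable add up to less than `q`, so one choice serves all
(`exists_eigenvalues`). Different groups have disjoint spectra, and
`tensor_blockVandermonde_injective` eliminates a group with a matrix polynomial that kills it and is
invertible at the eigenvalues of the others.

Repair: parity checks with exponent congruent to `t` mod `u` see a rack only through one virtual
node with eigenvalues `λ^u`. Apply to the host's tensor factor the coordinate functional at the
host's position. It is `-1` on all `s` eigenvectors of the host but nonzero on only one eigenvector
of any other rack of the group, so a helper matters only through `l/s` symbols while all `l` host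
symbols remain, under `s` distinct eigenvalues (`virtualNode_eq_zero`). The `nbar - 1 - dbar` silent
racks and the `s` host eigenvalues require `nbar - kbar` checks. For `t < u - v` there are exactly
that many; for `u - v ≤ t < u` there is one fewer, whence the further helper. The exponents `t < h`
give an `h × h` Vandermonde system for the failed nodes. -/

/-! ### Block Vandermonde systems, their annihilators, and gluing over tensor factors. -/

/-- The block Vandermonde matrix with rows `(m, r)`, `m < |T|`, columns `(ν, i)`, `ν ∈ T`, and
entries `κ ν i ^ m * w ν i r` has trivial kernel. -/
def BlockVandermondeInjective {ι R : Type*} [CommRing R] {s : ℕ} (T : Finset ι)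
    (κ : ι → Fin s → R) (w : ι → Fin s → Fin s → R) : Prop :=
  ∀ y : ι → Fin s → R,
    (∀ m < T.card, ∀ r, ∑ ν ∈ T, ∑ i, κ ν i ^ m * w ν i r * y ν i = 0) → ∀ ν ∈ T, y ν = 0

theorem vandermonde_finset_injective {ι R : Type*} [CommRing R] [IsDomain R] (T : Finset ι)
    (θ : ι → R) (hθ : Set.InjOn θ T) (z : ι → R)
    (h : ∀ m < T.card, ∑ ν ∈ T, θ ν ^ m * z ν = 0) : ∀ ν ∈ T, z ν = 0 := by
  intro ν hν
  have key := Matrix.eq_zero_of_forall_pow_sum_mul_pow_eq_zero (R := R) (n := T.card)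
    (f := fun k => θ (T.equivFin.symm k)) (v := fun k => z (T.equivFin.symm k)) ?_ ?_
  · have := congrFun key (T.equivFin ⟨ν, hν⟩)
    simpa using this
  · intro a b hab
    have := hθ (T.equivFin.symm a).2 (T.equivFin.symm b).2 hab
    exact T.equivFin.symm.injective (Subtype.ext this)
  · intro m
    have := h m m.2
    rw [← Finset.sum_coe_sort, ← T.equivFin.symm.sum_comp] at this
    simpa [mul_comm] using this

/-- Scalar eigenvalues make each row index `r` an ordinary Vandermonde system. This serves both for
the specialization in `exists_eigenvalues` and for the host's group in `virtualNode_eq_zero`. -/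
theorem BlockVandermondeInjective.of_scalar {ι R : Type*} [CommRing R] [IsDomain R] {s : ℕ}
    (T : Finset ι) (κ : ι → Fin s → R) (w : ι → Fin s → Fin s → R) (θ : ι → R)
    (hκ : ∀ ν ∈ T, ∀ i, κ ν i = θ ν) (hθ : Set.InjOn θ T)
    (hw : ∀ ν ∈ T, ∀ y : Fin s → R, (∀ r, ∑ i, w ν i r * y i = 0) → y = 0) :
    BlockVandermondeInjective T κ w := by
  intro y hy ν hν
  refine hw ν hν _ fun r => ?_
  refine vandermonde_finset_injective T θ hθ (fun ν => ∑ i, w ν i r * y ν i) (fun m hm => ?_) ν hν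
  rw [← hy m hm r]
  refine Finset.sum_congr rfl fun ν hν => ?_
  rw [Finset.mul_sum]
  refine Finset.sum_congr rfl fun i _ => ?_
  rw [hκ ν hν, mul_assoc]

theorem BlockVandermondeInjective.map {ι ι' R : Type*} [CommRing R] {s : ℕ}
    (T : Finset ι) (f : ι ↪ ι') (κ : ι' → Fin s → R) (w : ι' → Fin s → Fin s → R)
    (h : BlockVandermondeInjective T (fun ν => κ (f ν)) (fun ν => w (f ν))) :
    BlockVandermondeInjective (T.map f) κ w := by
  intro y hy ν hν
  obtain ⟨ν', hν', rfl⟩ := Finset.mem_map.1 hν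
  refine h (fun ν => y (f ν)) (fun m hm r => ?_) ν' hν'
  have := hy m (by simpa using hm) r
  simpa using this

/-- The linear map of the block Vandermonde matrix is bijective as soon as it is injective. -/
theorem BlockVandermondeInjective.exists_linearMap {ι F : Type*} [Field F] {s : ℕ} {T : Finset ι}
    {κ : ι → Fin s → F} {w : ι → Fin s → Fin s → F} (h : BlockVandermondeInjective T κ w) :
    ∃ f : (T × Fin s → F) →ₗ[F] (Fin T.card × Fin s → F),
      (∀ y p, f y p = ∑ ν : T, ∑ i, κ ν i ^ (p.1 : ℕ) * w ν i p.2 * y (ν, i)) ∧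
      Function.Bijective f := by
  let f : (T × Fin s → F) →ₗ[F] (Fin T.card × Fin s → F) :=
    { toFun := fun y p => ∑ ν : T, ∑ i, κ ν i ^ (p.1 : ℕ) * w ν i p.2 * y (ν, i)
      map_add' := by
        intro y z; funext p
        simp [mul_add, Finset.sum_add_distrib]
      map_smul' := by
        intro a y; funext p
        simp only [Pi.smul_apply, smul_eq_mul, RingHom.id_apply, Finset.mul_sum]
        refine Finset.sum_congr rfl fun _ _ => Finset.sum_congr rfl fun _ _ => ?_
        ring }
  have hf : ∀ y p, f y p = ∑ ν : T, ∑ i, κ ν i ^ (p.1 : ℕ) * w ν i p.2 * y (ν, i) :=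
    fun _ _ => rfl
  have hinj : Function.Injective f := by
    rw [injective_iff_map_eq_zero]
    intro y hy
    classical
    have := h (fun ν i => if hν : ν ∈ T then y (⟨ν, hν⟩, i) else 0) (fun m hm r => ?_)
    · funext p
      have := congrFun (this p.1 p.1.2) p.2
      simpa using this
    · rw [← Finset.sum_coe_sort]
      have := congrFun hy (⟨m, hm⟩, r)
      rw [hf] at this
      simpa using this
  refine ⟨f, hf, hinj, ?_⟩
  exact (LinearMap.injective_iff_surjective_of_finrank_eq_finrank (by simp)).1 hinj

/-- A monic matrix polynomial of degree `|T|` annihilating all eigenvectors `w ν i` at the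
eigenvalues `κ ν i`, and invertible at every other scalar. -/
theorem BlockVandermondeInjective.exists_annihilator {ι F : Type*} [Field F] {s : ℕ}
    {T : Finset ι} {κ : ι → Fin s → F} {w : ι → Fin s → Fin s → F}
    (h : BlockVandermondeInjective T κ w) :
    ∃ D : ℕ → Fin s → Fin s → F,
      (∀ ν ∈ T, ∀ i r,
        ∑ t ∈ Finset.range (T.card + 1), ∑ r', D t r r' * κ ν i ^ t * w ν i r' = 0) ∧
      ∀ μ : F, (∀ ν ∈ T, ∀ i, κ ν i ≠ μ) → ∀ v : Fin s → F,
        (∀ r, ∑ t ∈ Finset.range (T.card + 1), ∑ r', D t r r' * μ ^ t * v r' = 0) → v = 0 := by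
  classical
  obtain ⟨f, hf, hinj, hsurj⟩ := h.exists_linearMap
  obtain ⟨g, hg⟩ := f.exists_leftInverse_of_injective (LinearMap.ker_eq_bot.2 hinj)
  have hgf : ∀ y, g (f y) = y := fun y => LinearMap.congr_fun hg y
  -- the `r`-th row of the next block, as a functional on the columns
  let top : Fin s → (T × Fin s → F) → F := fun r y =>
    ∑ ν : T, ∑ i, κ ν i ^ T.card * w ν i r * y (ν, i)
  let P : Fin s → (Fin T.card × Fin s → F) →ₗ[F] F := fun r =>
    (∑ ν : T, ∑ i, (κ ν i ^ T.card * w ν i r) • LinearMap.proj (ν, i)) ∘ₗ g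
  have hP : ∀ r y, P r (f y) = top r y := by
    intro r y
    simp [P, top, hgf]
  -- Block row `T.card` is a combination of the lower ones, because those are invertible; the
  -- negated coefficients are the lower coefficients of the monic `D`.
  let D : ℕ → Fin s → Fin s → F := fun t r r' =>
    if ht : t < T.card then - P r (Pi.single (⟨t, ht⟩, r') 1) else if r = r' then 1 else 0
  have hD : ∀ (q : ℕ → Fin s → F) (r : Fin s),
      ∑ t ∈ Finset.range (T.card + 1), ∑ r', D t r r' * q t r'
        = q T.card r - P r (fun p => q p.1 p.2) := by
    intro q r
    rw [Finset.sum_range_succ, add_comm, sub_eq_add_neg]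
    congr 1
    · simp [D]
    · rw [Finset.sum_range]
      have : (fun p : Fin T.card × Fin s => q p.1 p.2)
          = ∑ p : Fin T.card × Fin s, q p.1 p.2 • Pi.single p (1 : F) := by
        funext p
        simp [Finset.sum_apply, Pi.single_apply]
      rw [this, map_sum, Fintype.sum_prod_type, ← Finset.sum_neg_distrib]
      refine Finset.sum_congr rfl fun t _ => ?_
      rw [← Finset.sum_neg_distrib]
      refine Finset.sum_congr rfl fun r' _ => ?_
      simp [D, mul_comm]
  refine ⟨D, ?_, ?_⟩
  · intro ν hν i r
    have h1 := hD (fun t r' => κ ν i ^ t * w ν i r') r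
    simp only [← mul_assoc] at h1
    rw [h1]
    have h2 : (fun p : Fin T.card × Fin s => κ ν i ^ (p.1 : ℕ) * w ν i p.2)
        = f (Pi.single (⟨ν, hν⟩, i) 1) := by
      funext p
      rw [hf]
      rw [Finset.sum_eq_single ⟨ν, hν⟩, Finset.sum_eq_single i]
      · simp
      · intro j _ hj; simp [hj]
      · simp
      · intro ν' _ hν'
        refine Finset.sum_eq_zero fun j _ => ?_
        simp [hν']
      · simp
    rw [h2, hP]
    simp only [top]
    rw [Finset.sum_eq_single ⟨ν, hν⟩, Finset.sum_eq_single i]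
    · simp
    · intro j _ hj; simp [hj]
    · simp
    · intro ν' _ hν'
      refine Finset.sum_eq_zero fun j _ => ?_
      simp [hν']
    · simp
  · intro μ hμ v hv
    obtain ⟨y, hy⟩ := hsurj (fun p => μ ^ (p.1 : ℕ) * v p.2)
    have hv' : ∀ r, top r y = μ ^ T.card * v r := by
      intro r
      have h1 := hD (fun t r' => μ ^ t * v r') r
      simp only [← mul_assoc] at h1
      rw [hv r, ← hy, hP] at h1
      exact (sub_eq_zero.1 h1.symm).symm
    have hall : ∀ m ≤ T.card, ∀ r,
        ∑ ν : T, ∑ i, κ ν i ^ m * w ν i r * y (ν, i) = μ ^ m * v r := by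
      intro m hm r
      rcases hm.lt_or_eq with hm | rfl
      · rw [← hf y (⟨m, hm⟩, r), hy]
      · exact hv' r
    -- Moment `m + 1` minus `μ` times moment `m` is zero for every `m < T.card`, so `(κ - μ) y` lies
    -- in the trivial kernel.
    have hz : (fun p : T × Fin s => (κ p.1 p.2 - μ) * y p) = 0 := by
      apply hinj
      rw [map_zero]
      funext p
      rw [hf, Pi.zero_apply]
      have h1 := hall (p.1 + 1) p.1.2 p.2
      have h2 := hall p.1 p.1.2.le p.2
      calc _ = (∑ ν : T, ∑ i, κ ν i ^ ((p.1 : ℕ) + 1) * w ν i p.2 * y (ν, i))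
            - μ * ∑ ν : T, ∑ i, κ ν i ^ (p.1 : ℕ) * w ν i p.2 * y (ν, i) := by
            simp only [Finset.mul_sum, ← Finset.sum_sub_distrib]
            refine Finset.sum_congr rfl fun _ _ => Finset.sum_congr rfl fun _ _ => ?_
            ring
        _ = 0 := by rw [h1, h2]; ring
    have hy0 : y = 0 := by
      funext p
      have := congrFun hz p
      simp only [Pi.zero_apply, mul_eq_zero, sub_eq_zero] at this
      exact this.resolve_left (hμ p.1 p.1.2 p.2)
    funext r
    have := hall 0 (Nat.zero_le _) r
    simpa [hy0] using this.symm

/-- Local injectivity in every group of nodes and disjointness of the spectra of different groups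
imply injectivity of the whole parity check matrix, whose nodes act on different tensor factors. -/
theorem tensor_blockVandermonde_injective {ι Γ F : Type*} [Field F] [DecidableEq Γ] {s : ℕ}
    (γ : ι → Γ) (κ : ι → Fin s → F) (w : ι → Fin s → Fin s → F)
    (hκ : ∀ ν ν' i i', γ ν ≠ γ ν' → κ ν i ≠ κ ν' i') (T : Finset ι)
    (hloc : ∀ a, BlockVandermondeInjective (T.filter (γ · = a)) κ w)
    (c : ι → (Γ → Fin s) → F)
    (hc : ∀ m < T.card, ∀ x, ∑ ν ∈ T, ∑ i,
      κ ν i ^ m * w ν i (x (γ ν)) * c ν (Function.update x (γ ν) i) = 0) :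
    ∀ ν ∈ T, c ν = 0 := by
  induction hN : T.card using Nat.strong_induction_on generalizing T c with
  | _ N ih =>
  subst hN
  rcases T.eq_empty_or_nonempty with rfl | ⟨ν₀, hν₀⟩
  · simp
  set a := γ ν₀ with ha
  have hne : (T.filter (γ · = a)).Nonempty := ⟨ν₀, by simp [hν₀, ha]⟩
  obtain ⟨D, hD1, hD2⟩ := (hloc a).exists_annihilator
  set δ := (T.filter (γ · = a)).card with hδ
  have hδpos : 0 < δ := hne.card_pos
  have hcard : δ + (T.filter (γ · ≠ a)).card = T.card :=
    Finset.card_filter_add_card_filter_not (s := T) (p := fun ν => γ ν = a)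
  -- nodes of the other groups
  have hother : ∀ ν ∈ T.filter (γ · ≠ a), c ν = 0 := by
    -- Apply `D` on coordinate `a`, the power `t` becoming a shift of the parity exponent. This
    -- kills group `a`, turns any other node into its image under `D (κ ν _)`, and leaves `T.card -
    -- δ` equations.
    have key := ih (T.filter (γ · ≠ a)).card (by omega) (T.filter (γ · ≠ a)) ?_
      (fun ν y => ∑ t ∈ Finset.range (δ + 1), ∑ r',
        D t (y a) r' * κ ν (y (γ ν)) ^ t * c ν (Function.update y a r')) ?_ rfl
    · intro ν hν
      have hνa := (Finset.mem_filter.1 hν).2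
      funext y
      have := hD2 (κ ν (y (γ ν))) ?_ (fun r' => c ν (Function.update y a r')) ?_
      · simpa using congrFun this (y a)
      · intro ν' hν' i
        refine hκ _ _ _ _ ?_
        rw [(Finset.mem_filter.1 hν').2]
        exact fun h => hνa h.symm
      · intro r
        have := congrFun (key ν hν) (Function.update y a r)
        simpa [Function.update_of_ne hνa] using this
    · intro b
      by_cases hb : b = a
      · have : (T.filter (γ · ≠ a)).filter (γ · = b) = ∅ := by
          ext ν; simp [hb]
        rw [this]
        intro y _ ν hν
        simp at hν
      · have : (T.filter (γ · ≠ a)).filter (γ · = b) = T.filter (γ · = b) := by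
          ext ν
          simp only [Finset.mem_filter]
          constructor
          · rintro ⟨⟨h1, -⟩, h2⟩; exact ⟨h1, h2⟩
          · rintro ⟨h1, h2⟩; exact ⟨⟨h1, h2 ▸ hb⟩, h2⟩
        rw [this]; exact hloc b
    · intro m hm x
      have h1 : ∑ t ∈ Finset.range (δ + 1), ∑ r', D t (x a) r' *
          ∑ ν ∈ T, ∑ i, κ ν i ^ (m + t) * w ν i (Function.update x a r' (γ ν)) *
            c ν (Function.update (Function.update x a r') (γ ν) i) = 0 := by
        refine Finset.sum_eq_zero fun t ht => Finset.sum_eq_zero fun r' _ => ?_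
        rw [hc, mul_zero]
        have := Finset.mem_range.1 ht
        omega
      have hswap : ∀ f : ℕ → Fin s → ι → Fin s → F,
          ∑ t ∈ Finset.range (δ + 1), ∑ r', D t (x a) r' * ∑ ν ∈ T, ∑ i, f t r' ν i
          = ∑ ν ∈ T, ∑ i, ∑ t ∈ Finset.range (δ + 1), ∑ r', D t (x a) r' * f t r' ν i := by
        intro f
        simp only [Finset.mul_sum]
        rw [Finset.sum_congr rfl fun t _ => Finset.sum_comm]
        rw [Finset.sum_comm]
        refine Finset.sum_congr rfl fun ν _ => ?_
        rw [Finset.sum_congr rfl fun t _ => Finset.sum_comm]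
        rw [Finset.sum_comm]
      rw [hswap, ← Finset.sum_filter_add_sum_filter_not T (γ · = a)] at h1
      rw [Finset.sum_eq_zero (s := T.filter (γ · = a)), zero_add] at h1
      · rw [← h1]
        refine Finset.sum_congr rfl fun ν hν => Finset.sum_congr rfl fun i _ => ?_
        have hνa : γ ν ≠ a := (Finset.mem_filter.1 hν).2
        rw [Finset.mul_sum]
        refine Finset.sum_congr rfl fun t _ => ?_
        rw [Finset.mul_sum]
        refine Finset.sum_congr rfl fun r' _ => ?_
        rw [Function.update_of_ne hνa, Function.update_of_ne hνa.symm, Function.update_self,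
          Function.update_comm hνa, pow_add]
        ring
      · intro ν hν
        have hνa : γ ν = a := (Finset.mem_filter.1 hν).2
        refine Finset.sum_eq_zero fun i _ => ?_
        have := hD1 ν hν i (x a)
        calc _ = κ ν i ^ m * c ν (Function.update x a i) *
              ∑ t ∈ Finset.range (δ + 1), ∑ r', D t (x a) r' * κ ν i ^ t * w ν i r' := by
              rw [Finset.mul_sum]
              refine Finset.sum_congr rfl fun t _ => ?_
              rw [Finset.mul_sum]
              refine Finset.sum_congr rfl fun r' _ => ?_
              rw [hνa, Function.update_self, Function.update_idem, pow_add]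
              ring
          _ = 0 := by rw [this, mul_zero]
  intro ν hν
  by_cases hνa : γ ν = a
  · funext x
    have := hloc a (fun ν i => c ν (Function.update x a i)) ?_ ν (by simp [hν, hνa])
    · simpa using congrFun this (x a)
    · intro m hm r
      have h1 := hc m (by omega) (Function.update x a r)
      rw [← Finset.sum_filter_add_sum_filter_not T (γ · = a)] at h1
      rw [Finset.sum_eq_zero (s := T.filter (¬ γ · = a)), add_zero] at h1
      · rw [← h1]
        refine Finset.sum_congr rfl fun ν hν => Finset.sum_congr rfl fun i _ => ?_
        rw [(Finset.mem_filter.1 hν).2, Function.update_self, Function.update_idem]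
      · intro ν hν
        rw [hother ν hν]
        simp
  · exact hother ν (by simp [hν, hνa])

/-! ### The eigenvectors: bases of the sum-zero hyperplane. -/

/-- The coordinates of `e_{b.succAbove i} - e_b`, for `b ∈ {0, …, s}` and `i < s`. -/
def diffVec (R : Type*) [CommRing R] {s : ℕ} (b : Fin (s + 1)) (i : Fin s) (a : Fin (s + 1)) : R :=
  (if a = b.succAbove i then 1 else 0) - (if a = b then 1 else 0)

theorem sum_diffVec (R : Type*) [CommRing R] {s : ℕ} (b : Fin (s + 1)) (i : Fin s) :
    ∑ a, diffVec R b i a = 0 := by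
  simp [diffVec]

theorem diffVec_last {R : Type*} [CommRing R] {s : ℕ} (b : Fin (s + 1)) (i : Fin s) :
    diffVec R b i (Fin.last s) = - ∑ a : Fin s, diffVec R b i a.castSucc := by
  have := sum_diffVec R b i
  rw [Fin.sum_univ_castSucc] at this
  exact eq_neg_of_add_eq_zero_right this

/-- A sum-zero vector is determined by its first `s` coordinates, and `y i` is the full coordinate
at `b.succAbove i`. -/
theorem diffVec_injective {R : Type*} [CommRing R] {s : ℕ} (b : Fin (s + 1)) (y : Fin s → R)
    (h : ∀ r : Fin s, ∑ i, diffVec R b i r.castSucc * y i = 0) : y = 0 := by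
  have hall : ∀ a : Fin (s + 1), ∑ i, diffVec R b i a * y i = 0 := by
    intro a
    refine Fin.lastCases ?_ h a
    simp only [diffVec_last, neg_mul, Finset.sum_mul, Finset.sum_neg_distrib]
    rw [Finset.sum_comm]
    simp [h]
  funext i
  have := hall (b.succAbove i)
  simpa [diffVec, Fin.succAbove_ne, Fin.succAbove_right_inj] using this

theorem diffVec_self {R : Type*} [CommRing R] {s : ℕ} (b : Fin (s + 1)) (i : Fin s) :
    diffVec R b i b = -1 := by
  simp [diffVec, (Fin.succAbove_ne b i).symm]

/-- The source of the bandwidth saving: coordinate `a` sees a single eigenvector of a rack at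
position `b ≠ a`, but by `diffVec_self` it sees every eigenvector of a rack at position `a`. -/
theorem diffVec_of_ne {R : Type*} [CommRing R] {s : ℕ} {b a : Fin (s + 1)} (h : a ≠ b)
    (i : Fin s) : diffVec R b i a = if a = b.succAbove i then 1 else 0 := by
  simp [diffVec, h]

/-! ### Determinants, degree counts and the choice of eigenvalues. -/

/-- The block Vandermonde matrix as a square matrix. -/
noncomputable def blockVandermonde {ι R : Type*} [CommRing R] {s : ℕ} (T : Finset ι)
    (κ : ι → Fin s → R) (w : ι → Fin s → Fin s → R) : Matrix (T × Fin s) (T × Fin s) R :=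
  fun p q => κ q.1 q.2 ^ (T.equivFin p.1 : ℕ) * w q.1 q.2 p.2

theorem det_blockVandermonde_ne_zero_iff {ι R : Type*} [DecidableEq ι] [CommRing R] [IsDomain R]
    {s : ℕ} (T : Finset ι) (κ : ι → Fin s → R) (w : ι → Fin s → Fin s → R) :
    (blockVandermonde T κ w).det ≠ 0 ↔ BlockVandermondeInjective T κ w := by
  rw [Ne, ← Matrix.exists_mulVec_eq_zero_iff, not_exists]
  have hmul : ∀ (y : ι → Fin s → R) (p : T × Fin s),
      (blockVandermonde T κ w).mulVec (fun q => y q.1 q.2) p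
        = ∑ ν ∈ T, ∑ i, κ ν i ^ (T.equivFin p.1 : ℕ) * w ν i p.2 * y ν i := by
    intro y p
    rw [Matrix.mulVec, dotProduct, Fintype.sum_prod_type, ← Finset.sum_coe_sort T]
    rfl
  constructor
  · intro h y hy ν hν
    by_contra hne
    refine h (fun q => y q.1 q.2) ⟨fun h0 => hne ?_, ?_⟩
    · funext i
      exact congrFun h0 (⟨ν, hν⟩, i)
    · funext p
      rw [hmul]
      exact hy _ (T.equivFin p.1).2 _
  · rintro h v ⟨hv, hv0⟩
    apply hv
    let y : ι → Fin s → R := fun ν i => if hν : ν ∈ T then v (⟨ν, hν⟩, i) else 0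
    have hvy : v = fun q => y q.1 q.2 := by
      funext q; simp [y]
    have := h y fun m hm r => by
      have := congrFun hv0 (T.equivFin.symm ⟨m, hm⟩, r)
      rw [hvy, hmul] at this
      simpa using this
    rw [hvy]
    funext q
    rw [this q.1 q.1.2]
    rfl

theorem map_det_blockVandermonde {ι R S : Type*} [DecidableEq ι] [CommRing R] [CommRing S]
    {s : ℕ} (f : R →+* S) (T : Finset ι) (κ : ι → Fin s → R) (w : ι → Fin s → Fin s → R) :
    f (blockVandermonde T κ w).det
      = (blockVandermonde T (fun ν i => f (κ ν i)) fun ν i r => f (w ν i r)).det := by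
  rw [RingHom.map_det]
  congr 1
  ext p q
  simp [blockVandermonde]

/-- Each Leibniz term takes one entry from every column. -/
theorem MvPolynomial.degreeOf_det_le {σ n R : Type*} [Fintype n] [DecidableEq n] [CommRing R]
    (x : σ) (M : Matrix n n (MvPolynomial σ R)) (d : n → ℕ)
    (h : ∀ p q, degreeOf x (M p q) ≤ d q) : degreeOf x M.det ≤ ∑ q, d q := by
  rw [Matrix.det_apply]
  refine (degreeOf_sum_le _ _ _).trans (Finset.sup_le fun τ _ => ?_)
  have h1 : degreeOf x (∏ i, M (τ i) i) ≤ ∑ q, d q :=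
    (degreeOf_prod_le _ _ _).trans (Finset.sum_le_sum fun q _ => h _ q)
  rcases Int.units_eq_one_or (Equiv.Perm.sign τ) with hs | hs
  · simpa [hs] using h1
  · simpa [hs, degreeOf_neg] using h1

/-- Each rack other than `j` that `T` meets uses up at least one node. For `δ` nodes in `t` racks
this leaves at most `δ - t + 1` in rack `j`. -/
theorem card_filter_fst_add_card_image_le {J U : Type*} [DecidableEq J]
    (T : Finset (J × U)) (j : J) :
    (T.filter (·.1 = j)).card + ((T.image Prod.fst).erase j).card ≤ T.card := by
  rw [← Finset.card_filter_add_card_filter_not (s := T) (p := fun ν => ν.1 = j)]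
  refine Nat.add_le_add_left (le_trans (Finset.card_le_card
    (t := (T.filter (¬ ·.1 = j)).image Prod.fst) ?_) Finset.card_image_le) _
  intro k hk
  obtain ⟨hkj, hk⟩ := Finset.mem_erase.1 hk
  obtain ⟨ν, hν, rfl⟩ := Finset.mem_image.1 hk
  exact Finset.mem_image.2 ⟨ν, Finset.mem_filter.2 ⟨hν, hkj⟩, rfl⟩

/-- The nonempty sets of nodes which meet the rack `j` and lie in the racks of `A`, weighted by the
degree which the eigenvalues of the rack `j` have in the corresponding determinants. -/
theorem sum_weight_le {J : Type*} [DecidableEq J] {u s : ℕ} (A : Finset J) (j : J)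
    (hj : j ∈ A) (hA : A.card ≤ s + 1) (𝒯 : Finset (Finset (J × Fin u)))
    (h𝒯 : ∀ T ∈ 𝒯, j ∈ T.image Prod.fst ∧ T.image Prod.fst ⊆ A) :
    ∑ T ∈ 𝒯, (T.filter (·.1 = j)).card * (T.card - 1)
      ≤ ∑ t ∈ Finset.Icc 1 (s + 1), s.choose (t - 1) *
          ∑ δ ∈ Finset.Icc t (u * t), (u * t).choose δ * ((δ - t + 1) * (δ - 1)) := by
  set g : ℕ → ℕ → ℕ := fun t δ => (δ - t + 1) * (δ - 1) with hg
  set h : ℕ → ℕ := fun t => ∑ δ ∈ Finset.Icc t (u * t), (u * t).choose δ * g t δ with hh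
  -- Sort the sets by the other racks `W` they meet. A fibre is bounded by all subsets of the `u *
  -- (W.card + 1)` nodes of `insert j W` having at least `W.card + 1` elements.
  have hmaps : ∀ T ∈ 𝒯, (T.image Prod.fst).erase j ∈ (A.erase j).powerset := fun T hT =>
    Finset.mem_powerset.2 (Finset.erase_subset_erase _ (h𝒯 T hT).2)
  rw [← Finset.sum_fiberwise_of_maps_to hmaps]
  have hfib : ∀ W ∈ (A.erase j).powerset,
      ∑ T ∈ 𝒯 with (T.image Prod.fst).erase j = W, (T.filter (·.1 = j)).card * (T.card - 1)
        ≤ h (W.card + 1) := by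
    intro W hW
    have hjW : j ∉ W := fun hjW => by
      simpa using Finset.mem_powerset.1 hW hjW
    set X : Finset (J × Fin u) := (insert j W) ×ˢ Finset.univ with hX
    have hXcard : X.card = u * (W.card + 1) := by
      rw [hX, Finset.card_product, Finset.card_insert_of_notMem hjW, Finset.card_univ,
        Fintype.card_fin, mul_comm]
    set k : ℕ → ℕ := fun m => if W.card + 1 ≤ m then g (W.card + 1) m else 0 with hk
    calc _ ≤ ∑ T ∈ 𝒯 with (T.image Prod.fst).erase j = W, k T.card := by
          refine Finset.sum_le_sum fun T hT => ?_
          obtain ⟨hT𝒯, rfl⟩ := Finset.mem_filter.1 hT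
          have h1 := card_filter_fst_add_card_image_le T j
          have h2 : 0 < (T.filter (·.1 = j)).card := by
            obtain ⟨ν, hν, hνj⟩ := Finset.mem_image.1 (h𝒯 T hT𝒯).1
            exact Finset.card_pos.2 ⟨ν, Finset.mem_filter.2 ⟨hν, hνj⟩⟩
          rw [hk]
          simp only [hg]
          rw [if_pos (by omega)]
          exact Nat.mul_le_mul_right _ (by omega)
      _ ≤ ∑ T ∈ X.powerset, k T.card := by
          refine Finset.sum_le_sum_of_subset fun T hT => ?_
          obtain ⟨hT𝒯, rfl⟩ := Finset.mem_filter.1 hT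
          rw [Finset.mem_powerset]
          intro ν hν
          rw [hX, Finset.insert_erase (h𝒯 T hT𝒯).1]
          exact Finset.mem_product.2 ⟨Finset.mem_image_of_mem _ hν, Finset.mem_univ _⟩
      _ = h (W.card + 1) := by
          rw [Finset.sum_powerset_apply_card, hXcard, hk]
          simp only [smul_eq_mul, mul_ite, mul_zero, hh]
          rw [← Finset.sum_filter]
          refine Finset.sum_congr ?_ fun _ _ => rfl
          ext m
          simp only [Finset.mem_filter, Finset.mem_range, Finset.mem_Icc]
          omega
  refine (Finset.sum_le_sum hfib).trans ?_
  rw [Finset.sum_powerset_apply_card (fun m => h (m + 1)), Finset.card_erase_of_mem hj]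
  have : ∑ t ∈ Finset.Icc 1 (s + 1), s.choose (t - 1) * h t
      = ∑ m ∈ Finset.range (s + 1), s.choose m * h (m + 1) := by
    have h1 := Finset.sum_Ico_add' (fun t => s.choose (t - 1) * h t) 0 (s + 1) 1
    simp only [Nat.add_sub_cancel] at h1
    rw [Finset.range_eq_Ico, h1]
    refine Finset.sum_congr ?_ fun _ _ => rfl
    ext t
    simp only [Finset.mem_Icc, Finset.mem_Ico]
    omega
  rw [this]
  calc _ ≤ ∑ m ∈ Finset.range (A.card - 1 + 1), s.choose m * h (m + 1) := by
        refine Finset.sum_le_sum fun m _ => ?_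
        rw [smul_eq_mul]
        exact Nat.mul_le_mul_right _ (Nat.choose_le_choose _ (by omega))
    _ ≤ _ := Finset.sum_le_sum_of_subset (Finset.range_mono (by omega))

/-- Termwise, with `δ = t + d`: if `u = 1` then `d = 0` and both linear factors agree; if `u ≥ 2`
then `u` absorbs the `1/2`, and `t + d - 1 ≤ 2t + d - 2`. The extra binomial in `Omega` is at least
`1`. -/
theorem weight_le_mul_Omega (s u : ℕ) (hu : 1 ≤ u) :
    ((∑ t ∈ Finset.Icc 1 (s + 1), s.choose (t - 1) *
          ∑ δ ∈ Finset.Icc t (u * t), (u * t).choose δ * ((δ - t + 1) * (δ - 1)) : ℕ) : ℚ)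
      ≤ u * Omega (s + 1) u := by
  rw [Omega, Nat.cast_sum, ← mul_assoc, Finset.mul_sum]
  refine Finset.sum_le_sum fun t ht => ?_
  rw [Nat.cast_mul, Nat.cast_sum, Finset.mul_sum, Finset.mul_sum]
  refine Finset.sum_le_sum fun δ hδ => ?_
  obtain ⟨ht1, -⟩ := Finset.mem_Icc.1 ht
  obtain ⟨htδ, hδu⟩ := Finset.mem_Icc.1 hδ
  have hcomp : (1 : ℚ) ≤ ((δ - 1).choose (t - 1) : ℚ) := by
    exact_mod_cast Nat.choose_pos (by omega)
  obtain ⟨d, rfl⟩ := Nat.exists_eq_add_of_le htδ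
  have e1 : t + d - t + 1 = d + 1 := by omega
  rw [e1, Nat.add_sub_cancel]
  have ht1' : (1 : ℚ) ≤ t := by exact_mod_cast ht1
  have hd0 : (0 : ℚ) ≤ d := Nat.cast_nonneg _
  push_cast [Nat.cast_sub (show 1 ≤ t + d by omega)]
  have hmain : ((d : ℚ) + 1) * (t + d - 1) ≤ u * (1 / 2) * ((d + 1) * (2 * t + d - 2)) := by
    rcases hu.eq_or_lt with rfl | hu2
    · have : d = 0 := by omega
      subst this
      push_cast
      linarith
    · have hu2' : (2 : ℚ) ≤ u := by exact_mod_cast hu2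
      have : (0 : ℚ) ≤ (d + 1) * (2 * t + d - 2) := mul_nonneg (by linarith) (by linarith)
      nlinarith
  have hA : (0 : ℚ) ≤ (s.choose (t - 1) : ℚ) * ((u * t).choose (t + d) : ℚ) := by positivity
  have hB : (0 : ℚ) ≤ u * (1 / 2) * ((d + 1) * (2 * t + d - 2)) :=
    mul_nonneg (by positivity) (mul_nonneg (by linarith) (by linarith))
  calc _ = ((s.choose (t - 1) : ℚ) * ((u * t).choose (t + d) : ℚ))
          * (((d : ℚ) + 1) * (t + d - 1)) := by ring
    _ ≤ ((s.choose (t - 1) : ℚ) * ((u * t).choose (t + d) : ℚ))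
          * (u * (1 / 2) * ((d + 1) * (2 * t + d - 2))) := by gcongr
    _ ≤ (((s.choose (t - 1) : ℚ) * ((u * t).choose (t + d) : ℚ))
          * (u * (1 / 2) * ((d + 1) * (2 * t + d - 2)))) * ((t + d - 1).choose (t - 1) : ℚ) :=
        le_mul_of_one_le_right (mul_nonneg hA hB) hcomp
    _ = _ := by ring

open MvPolynomial in
/-- Over a large enough field the eigenvalues can be chosen nonzero, with distinct `u`-th powers,
and such that every set of nodes inside one group of racks has an injective block Vandermonde
matrix. -/
theorem exists_eigenvalues {F J Γ : Type*} [Field F] [Fintype F] [Fintype J] [DecidableEq J]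
    [DecidableEq Γ] {u s : ℕ} (hu : 1 ≤ u) (γ : J → Γ) (b : J → Fin (s + 1))
    (hγ : ∀ a, (Finset.univ.filter (γ · = a)).card ≤ s + 1)
    (ζ : Fin u → F) (hζ : Function.Injective ζ) (hζ0 : ∀ g, ζ g ≠ 0)
    (hq : ((Fintype.card J * s : ℕ) : ℚ) * u + u * Omega (s + 1) u + 1 ≤ Fintype.card F) :
    ∃ lam : J → Fin s → F, (∀ j i, lam j i ≠ 0) ∧
      (∀ j i j' i', lam j i ^ u = lam j' i' ^ u → j = j' ∧ i = i') ∧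
      ∀ T : Finset (J × Fin u), (∀ ν ∈ T, ∀ ν' ∈ T, γ ν.1 = γ ν'.1) →
        BlockVandermondeInjective T (fun ν i => ζ ν.2 * lam ν.1 i)
          (fun ν i r => diffVec F (b ν.1) i r.castSucc) := by
  classical
  let N := Fintype.card (J × Fin s)
  have hN : N = Fintype.card J * s := by simp [N]
  let 𝒯 : Finset (Finset (J × Fin u)) :=
    Finset.univ.filter fun T => ∀ ν ∈ T, ∀ ν' ∈ T, γ ν.1 = γ ν'.1
  let κ : J × Fin u → Fin s → MvPolynomial (J × Fin s) F := fun ν i => C (ζ ν.2) * X (ν.1, i)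
  let w : J × Fin u → Fin s → Fin s → MvPolynomial (J × Fin s) F := fun ν i r => C (diffVec F (b ν.1) i r.castSucc)
  let d : Finset (J × Fin u) → MvPolynomial (J × Fin s) F := fun T => (blockVandermonde T κ w).det
  let V : MvPolynomial (J × Fin s) F := (Matrix.vandermonde fun k : Fin N =>
    (X ((Fintype.equivFin (J × Fin s)).symm k) : MvPolynomial (J × Fin s) F) ^ u).det
  let Z : MvPolynomial (J × Fin s) F := ∏ p : (J × Fin s), X p
  have hd0 : ∀ T, d T ≠ 0 := by
    intro T
    -- Identifying all variables of a rack makes the eigenvalues scalars `ζ g * X j`, pairwise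
    -- distinct, so the specialized determinant is nonzero.
    let φ : MvPolynomial (J × Fin s) F →+* MvPolynomial J F := (aeval fun p : (J × Fin s) => (X p.1 : MvPolynomial J F)).toRingHom
    intro h0
    have h1 : φ (d T) = 0 := by rw [h0, map_zero]
    rw [map_det_blockVandermonde] at h1
    refine (det_blockVandermonde_ne_zero_iff T _ _).2 ?_ h1
    refine BlockVandermondeInjective.of_scalar T _ _
      (fun ν => C (ζ ν.2) * (X ν.1 : MvPolynomial J F)) ?_ ?_ ?_
    · intro ν _ i
      simp [κ, φ]
    · rintro ⟨j, g⟩ - ⟨j', g'⟩ - h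
      have h' : monomial (Finsupp.single j 1) (ζ g) = monomial (Finsupp.single j' 1) (ζ g') := by
        simpa [C_mul_X_eq_monomial] using h
      rw [monomial_eq_monomial_iff] at h'
      rcases h' with ⟨h1, h2⟩ | ⟨h1, -⟩
      · rw [hζ h2, Finsupp.single_left_injective one_ne_zero h1]
      · exact absurd h1 (hζ0 g)
    · intro ν _ y hy
      refine diffVec_injective (b ν.1) y fun r => ?_
      rw [← hy r]
      refine Finset.sum_congr rfl fun i _ => ?_
      simp [w, φ, diffVec]
  have hV0 : V ≠ 0 := by
    rw [Matrix.det_vandermonde_ne_zero_iff]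
    intro k k' hkk
    have h1 : (monomial (Finsupp.single ((Fintype.equivFin (J × Fin s)).symm k) u) (1 : F))
        = monomial (Finsupp.single ((Fintype.equivFin (J × Fin s)).symm k') u) 1 := by
      simpa only [X_pow_eq_monomial] using hkk
    rw [monomial_eq_monomial_iff] at h1
    rcases h1 with ⟨h1, -⟩ | ⟨h1, -⟩
    · exact (Fintype.equivFin (J × Fin s)).symm.injective
        (Finsupp.single_left_injective (by omega) h1)
    · exact absurd h1 one_ne_zero
  have hZ0 : Z ≠ 0 := Finset.prod_ne_zero_iff.2 fun p _ => X_ne_zero p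
  have hprod0 : Z * V * ∏ T ∈ 𝒯, d T ≠ 0 :=
    mul_ne_zero (mul_ne_zero hZ0 hV0) (Finset.prod_ne_zero_iff.2 fun T _ => hd0 T)
  have hdegZ : ∀ p : (J × Fin s), degreeOf p Z ≤ 1 := by
    intro p
    refine (degreeOf_prod_le _ _ _).trans ?_
    simp only [degreeOf_X, Finset.sum_ite_eq, Finset.mem_univ, if_true, le_refl]
  have hdegV : ∀ p : (J × Fin s), degreeOf p V ≤ u * (N - 1) := by
    intro p
    -- Transposing puts each variable into a single column, as the columnwise degree bound needs.
    have h1 : V = ((Matrix.vandermonde fun k : Fin N =>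
      (X ((Fintype.equivFin (J × Fin s)).symm k) : MvPolynomial (J × Fin s) F) ^ u).transpose).det := (Matrix.det_transpose _).symm
    rw [h1]
    refine (degreeOf_det_le p _
      (fun k => if (Fintype.equivFin (J × Fin s)).symm k = p then u * (N - 1) else 0) ?_).trans ?_
    · intro m k
      rw [Matrix.transpose_apply, Matrix.vandermonde_apply, ← pow_mul]
      refine (degreeOf_pow_le _ _ _).trans ?_
      rw [degreeOf_X]
      by_cases hk : (Fintype.equivFin (J × Fin s)).symm k = p
      · rw [if_pos hk, if_pos hk.symm, mul_one]
        exact Nat.mul_le_mul_left _ (by have := m.2; omega)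
      · rw [if_neg hk, if_neg (fun h => hk h.symm), mul_zero]
    · rw [Finset.sum_ite, Finset.sum_const_zero, add_zero, Finset.sum_const]
      have : (Finset.univ.filter fun k => (Fintype.equivFin (J × Fin s)).symm k = p).card ≤ 1 := by
        refine Finset.card_le_one.2 fun k hk k' hk' => ?_
        apply (Fintype.equivFin (J × Fin s)).symm.injective
        rw [(Finset.mem_filter.1 hk).2, (Finset.mem_filter.1 hk').2]
      calc _ ≤ 1 • (u * (N - 1)) := Nat.mul_le_mul_right _ this
        _ = _ := one_smul _ _
  have hdegd : ∀ (p : (J × Fin s)) T, degreeOf p (d T) ≤ (T.filter (·.1 = p.1)).card * (T.card - 1) := by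
    intro p T
    refine (degreeOf_det_le p _ (fun q : T × Fin s =>
      if q.1.1.1 = p.1 ∧ q.2 = p.2 then T.card - 1 else 0) ?_).trans ?_
    · intro q q'
      refine (degreeOf_mul_le _ _ _).trans ?_
      rw [degreeOf_C, add_zero, mul_pow, ← C_pow]
      refine (degreeOf_C_mul_le _ _ _).trans ?_
      refine (degreeOf_pow_le _ _ _).trans ?_
      rw [degreeOf_X]
      by_cases hq' : q'.1.1.1 = p.1 ∧ q'.2 = p.2
      · rw [if_pos hq', if_pos (Prod.ext hq'.1.symm hq'.2.symm), mul_one]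
        have := (T.equivFin q.1).2
        omega
      · rw [if_neg hq', if_neg, mul_zero]
        rintro rfl
        exact hq' ⟨rfl, rfl⟩
    · rw [Fintype.sum_prod_type]
      rw [Finset.sum_coe_sort T (fun ν => ∑ i, if ν.1 = p.1 ∧ i = p.2 then T.card - 1 else 0)]
      rw [← smul_eq_mul, ← Finset.sum_const, Finset.sum_filter]
      refine Finset.sum_le_sum fun ν _ => ?_
      by_cases hν : ν.1 = p.1 <;> simp [hν]
  have hdeg : ∀ p : (J × Fin s), degreeOf p (Z * V * ∏ T ∈ 𝒯, d T) < (Finset.univ : Finset F).card := by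
    intro p
    have hsum : ∑ T ∈ 𝒯, degreeOf p (d T)
        ≤ ∑ t ∈ Finset.Icc 1 (s + 1), s.choose (t - 1) *
          ∑ δ ∈ Finset.Icc t (u * t), (u * t).choose δ * ((δ - t + 1) * (δ - 1)) := by
      refine (Finset.sum_le_sum fun T _ => hdegd p T).trans ?_
      rw [← Finset.sum_filter_add_sum_filter_not 𝒯 (fun T => p.1 ∈ T.image Prod.fst)]
      rw [Finset.sum_eq_zero (s := 𝒯.filter fun T => ¬ p.1 ∈ T.image Prod.fst), add_zero]
      · refine sum_weight_le (Finset.univ.filter (γ · = γ p.1)) p.1 (by simp) (hγ _) _ ?_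
        intro T hT
        obtain ⟨hT, hpT⟩ := Finset.mem_filter.1 hT
        refine ⟨hpT, fun k hk => ?_⟩
        obtain ⟨ν, hν, hνp⟩ := Finset.mem_image.1 hpT
        obtain ⟨ν', hν', rfl⟩ := Finset.mem_image.1 hk
        rw [Finset.mem_filter, ← hνp]
        exact ⟨Finset.mem_univ _, (Finset.mem_filter.1 hT).2 _ hν' _ hν⟩
      · intro T hT
        have : T.filter (·.1 = p.1) = ∅ := by
          refine Finset.filter_eq_empty_iff.2 fun ν hν h => (Finset.mem_filter.1 hT).2 ?_
          exact Finset.mem_image.2 ⟨ν, hν, h⟩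
        rw [this]; simp
    have h1 : degreeOf p (Z * V * ∏ T ∈ 𝒯, d T)
        ≤ 1 + u * (N - 1) + ∑ T ∈ 𝒯, degreeOf p (d T) :=
      (degreeOf_mul_le _ _ _).trans (add_le_add ((degreeOf_mul_le _ _ _).trans
        (add_le_add (hdegZ p) (hdegV p))) (degreeOf_prod_le _ _ _))
    have hNpos : 1 ≤ N := Fintype.card_pos_iff.2 ⟨p⟩
    have h2 : 1 + u * (N - 1) ≤ N * u := by
      obtain ⟨k, hk⟩ := Nat.exists_eq_add_of_le hNpos
      rw [hk, Nat.add_sub_cancel_left]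
      nlinarith
    have h3 : degreeOf p (Z * V * ∏ T ∈ 𝒯, d T)
        ≤ N * u + ∑ t ∈ Finset.Icc 1 (s + 1), s.choose (t - 1) *
          ∑ δ ∈ Finset.Icc t (u * t), (u * t).choose δ * ((δ - t + 1) * (δ - 1)) :=
      h1.trans (add_le_add h2 hsum)
    have h4 : (degreeOf p (Z * V * ∏ T ∈ 𝒯, d T) : ℚ) ≤ N * u + u * Omega (s + 1) u := by
      refine (Nat.cast_le.2 h3).trans ?_
      rw [Nat.cast_add, Nat.cast_mul]
      gcongr
      exact weight_le_mul_Omega s u hu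
    rw [hN] at h4
    have h5 : (degreeOf p (Z * V * ∏ T ∈ 𝒯, d T) : ℚ) < Fintype.card F := by linarith
    rw [Finset.card_univ]
    exact_mod_cast h5
  obtain ⟨x, hx⟩ : ∃ x : (J × Fin s) → F, eval x (Z * V * ∏ T ∈ 𝒯, d T) ≠ 0 := by
    by_contra! hcon
    exact hprod0 (eq_zero_of_eval_zero_at_prod_finset _ (fun _ => Finset.univ) hdeg
      fun x _ => hcon x)
  rw [map_mul, map_mul, map_prod, map_prod] at hx
  obtain ⟨⟨hxZ, hxV⟩, hxd⟩ := And.imp_left mul_ne_zero_iff.1 (mul_ne_zero_iff.1 hx)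
  refine ⟨fun j i => x (j, i), ?_, ?_, ?_⟩
  · intro j i
    simpa using Finset.prod_ne_zero_iff.1 hxZ (j, i) (Finset.mem_univ _)
  · intro j i j' i' h
    have h1 : (Matrix.vandermonde fun k : Fin N => x ((Fintype.equivFin (J × Fin s)).symm k) ^ u).det ≠ 0 := by
      convert hxV
      rw [RingHom.map_det]
      congr 1
      ext k m
      simp [Matrix.vandermonde_apply]
    rw [Matrix.det_vandermonde_ne_zero_iff] at h1
    have h2 := @h1 (Fintype.equivFin (J × Fin s) (j, i)) (Fintype.equivFin (J × Fin s) (j', i')) (by simpa using h)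
    exact Prod.ext_iff.1 ((Fintype.equivFin (J × Fin s)).injective h2)
  · intro T hT
    rw [← det_blockVandermonde_ne_zero_iff]
    have h1 := Finset.prod_ne_zero_iff.1 hxd T (by simpa [𝒯] using hT)
    rw [map_det_blockVandermonde] at h1
    simpa [κ, w] using h1

/-! ### Locators, virtual nodes and the repair equations. -/

theorem BlockVandermondeInjective.congr {ι R : Type*} [CommRing R] {s : ℕ} {T : Finset ι}
    {κ κ' : ι → Fin s → R} {w w' : ι → Fin s → Fin s → R}
    (h : BlockVandermondeInjective T κ w) (hκ : ∀ ν ∈ T, κ' ν = κ ν) (hw : ∀ ν ∈ T, w' ν = w ν) :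
    BlockVandermondeInjective T κ' w' := by
  intro y hy
  refine h y fun m hm r => ?_
  rw [← hy m hm r]
  refine Finset.sum_congr rfl fun ν hν => ?_
  rw [hκ ν hν, hw ν hν]

theorem IsPrimitiveRoot.sum_fin_pow_eq_zero {R : Type*} [CommRing R] [IsDomain R] {u : ℕ} {ξ : R}
    (hξ : IsPrimitiveRoot ξ u) {m : ℕ} (hm : ¬ u ∣ m) : ∑ g : Fin u, (ξ ^ (g : ℕ)) ^ m = 0 := by
  have h1 : ξ ^ m ≠ 1 := fun h => hm (hξ.dvd_of_pow_eq_one m h)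
  have h2 := geom_sum_mul (ξ ^ m) u
  rw [← pow_mul, mul_comm m u, pow_mul, hξ.pow_eq_one, one_pow, sub_self, mul_eq_zero] at h2
  have h3 := h2.resolve_right (sub_ne_zero.2 h1)
  rw [Finset.sum_range] at h3
  rw [← h3]
  refine Finset.sum_congr rfl fun g _ => ?_
  rw [← pow_mul, ← pow_mul, mul_comm]

/-- The locators of a rack-aware code: every rack has a group and a position in it, and `s`
eigenvalues; the eigenvalues of the `g`-th node of a rack are those of the rack times `ξ ^ g`. -/
structure RackLocators (F : Type*) [Field F] (nbar u s : ℕ) (Γ : Type*) where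
  group : Fin nbar → Γ
  pos : Fin nbar → Fin (s + 1)
  ξ : F
  lam : Fin nbar → Fin s → F
  eq_of_group_pos : ∀ j j', group j = group j' → pos j = pos j' → j = j'
  primitive : IsPrimitiveRoot ξ u
  lam_ne_zero : ∀ j i, lam j i ≠ 0
  lam_pow_injective : ∀ j i j' i', lam j i ^ u = lam j' i' ^ u → j = j' ∧ i = i'
  locally_injective : ∀ T : Finset (Fin nbar × Fin u),
    (∀ ν ∈ T, ∀ ν' ∈ T, group ν.1 = group ν'.1) →
      BlockVandermondeInjective T (fun ν i => ξ ^ (ν.2 : ℕ) * lam ν.1 i)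
        (fun ν i r => diffVec F (pos ν.1) i r.castSucc)

namespace RackLocators

variable {F : Type*} [Field F] {nbar u s : ℕ} {Γ : Type*}

/-- Local injectivity for the racks of one group with the `u`-th powers of the eigenvalues. -/
theorem rack_locally_injective (L : RackLocators F nbar u s Γ) (T : Finset (Fin nbar))
    (hT : ∀ j ∈ T, ∀ j' ∈ T, L.group j = L.group j') :
    BlockVandermondeInjective T (fun j i => L.lam j i ^ u)
      (fun j i r => diffVec F (L.pos j) i r.castSucc) := by
  intro y hy j hj
  -- For `u = 0` all `u`-th powers are `1`, so there is at most one pair `(j, i)`.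
  rcases Nat.eq_zero_or_pos u with hu | hu
  · subst hu
    have h0 : ∀ i i' : Fin s, i = i' := fun i i' =>
      (L.lam_pow_injective j i j i' (by simp)).2
    refine diffVec_injective (L.pos j) _ fun r => ?_
    have hsing : T = {j} := by
      refine Finset.eq_singleton_iff_unique_mem.2 ⟨hj, fun j' hj' => ?_⟩
      exact (L.lam_pow_injective j' r j r (by simp)).1
    have := hy 0 (by rw [hsing]; simp) r
    simpa [hsing] using this
  -- Repeat `y j` on all `u` nodes of rack `j`: sums over roots of unity kill the exponents not
  -- divisible by `u`, and the others are the given rack equations.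
  refine L.locally_injective (T ×ˢ Finset.univ) ?_ (fun ν => y ν.1) ?_ (j, ⟨0, hu⟩) (by simp [hj])
  · intro ν hν ν' hν'
    exact hT _ (Finset.mem_product.1 hν).1 _ (Finset.mem_product.1 hν').1
  · intro m hm r
    rw [Finset.card_product, Finset.card_univ, Fintype.card_fin] at hm
    rw [Finset.sum_product]
    have hsum : ∀ j ∈ T, ∑ g : Fin u, ∑ i, (L.ξ ^ (g : ℕ) * L.lam j i) ^ m *
        diffVec F (L.pos j) i r.castSucc * y j i
        = (∑ g : Fin u, (L.ξ ^ (g : ℕ)) ^ m) *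
          ∑ i, L.lam j i ^ m * diffVec F (L.pos j) i r.castSucc * y j i := by
      intro j _
      rw [Finset.sum_mul]
      refine Finset.sum_congr rfl fun g _ => ?_
      rw [Finset.mul_sum]
      refine Finset.sum_congr rfl fun i _ => ?_
      rw [mul_pow]
      ring
    rw [Finset.sum_congr rfl hsum, ← Finset.mul_sum]
    by_cases hum : u ∣ m
    · obtain ⟨m', rfl⟩ := hum
      have := hy m' (by nlinarith) r
      simp only [← pow_mul] at this
      rw [this, mul_zero]
    · rw [L.primitive.sum_fin_pow_eq_zero hum, zero_mul]

/-- The coordinates on `F^s` of the functional which is dual to `b` up to sign. -/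
def rowVec (F : Type*) [Field F] {s : ℕ} (b : Fin (s + 1)) (a : Fin s) : F :=
  (if b = a.castSucc then 1 else 0) - (if b = Fin.last s then 1 else 0)

/-- At the last position the omitted coordinate is minus the sum of the others, hence the constant
`-1` there. -/
theorem sum_rowVec_mul_diffVec (b b' : Fin (s + 1)) (i : Fin s) :
    ∑ a, rowVec F b a * diffVec F b' i a.castSucc = diffVec F b' i b := by
  refine Fin.lastCases ?_ (fun k => ?_) b
  · simp [rowVec, diffVec_last, (Fin.castSucc_ne_last _).symm]
  · simp [rowVec, Fin.castSucc_ne_last]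

/-- The content of the virtual node of the rack `j` for the residue class of `t` modulo `u`. -/
def virtualNode (L : RackLocators F nbar u s Γ) (t : ℕ) (j : Fin nbar)
    (X : Fin u → (Γ → Fin s) → F) (x : Γ → Fin s) : F :=
  L.lam j (x (L.group j)) ^ t * ∑ g : Fin u, (L.ξ ^ (g : ℕ)) ^ t * X g x

variable [DecidableEq Γ]

/-- The `(m, x)` parity check. -/
def parity (L : RackLocators F nbar u s Γ) (m : ℕ) (x : Γ → Fin s)
    (c : Fin nbar × Fin u → (Γ → Fin s) → F) : F :=
  ∑ ν, ∑ i, (L.ξ ^ (ν.2 : ℕ) * L.lam ν.1 i) ^ m *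
    diffVec F (L.pos ν.1) i (x (L.group ν.1)).castSucc * c ν (Function.update x (L.group ν.1) i)

/-- A solution of the first `|T|` parity checks which is supported on `T` vanishes. -/
theorem eq_zero_of_parity (L : RackLocators F nbar u s Γ) (T : Finset (Fin nbar × Fin u))
    (c : Fin nbar × Fin u → (Γ → Fin s) → F) (hT : ∀ ν ∉ T, c ν = 0)
    (hc : ∀ m < T.card, ∀ x, L.parity m x c = 0) : c = 0 := by
  have key := tensor_blockVandermonde_injective (fun ν : Fin nbar × Fin u => L.group ν.1)
    (fun ν i => L.ξ ^ (ν.2 : ℕ) * L.lam ν.1 i)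
    (fun ν i r => diffVec F (L.pos ν.1) i r.castSucc) ?_ T ?_ c ?_
  · funext ν
    by_cases hν : ν ∈ T
    · exact key ν hν
    · exact hT ν hν
  · intro ν ν' i i' hne h
    apply hne
    have h1 := congrArg (· ^ u) h
    simp only [mul_pow, ← pow_mul, mul_comm _ u] at h1
    simp only [pow_mul, L.primitive.pow_eq_one, one_pow, one_mul] at h1
    rw [(L.lam_pow_injective _ _ _ _ h1).1]
  · intro a
    refine L.locally_injective _ fun ν hν ν' hν' => ?_
    rw [(Finset.mem_filter.1 hν).2, (Finset.mem_filter.1 hν').2]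
  · intro m hm x
    rw [← hc m hm x, parity]
    refine Finset.sum_subset (Finset.subset_univ _) fun ν _ hν => ?_
    simp [hT ν hν]

/-- What the rack `j` sends to the host rack `j₀`, for the residue class of `t` modulo `u`. -/
def message (L : RackLocators F nbar u s Γ) (j₀ : Fin nbar) (t : ℕ) (j : Fin nbar)
    (X : Fin u → (Γ → Fin s) → F) (x : Γ → Fin s) : F :=
  ∑ i, (if L.group j = L.group j₀ then diffVec F (L.pos j) i (L.pos j₀)
      else rowVec F (L.pos j₀) i) *
    L.virtualNode t j X (Function.update x (L.group j₀) i)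

/-- Since `ξ ^ u = 1`, the weight `ξ ^ (g * (t + u * m))` does not depend on `m`, and the nodes of a
rack merge into one with eigenvalues `λ ^ u`. -/
theorem virtual_parity (L : RackLocators F nbar u s Γ) (t m : ℕ) (x : Γ → Fin s)
    (c : Fin nbar × Fin u → (Γ → Fin s) → F) :
    L.parity (t + u * m) x c = ∑ j, ∑ i, (L.lam j i ^ u) ^ m *
      diffVec F (L.pos j) i (x (L.group j)).castSucc *
      L.virtualNode t j (fun g => c (j, g)) (Function.update x (L.group j) i) := by
  rw [parity, Fintype.sum_prod_type]
  refine Finset.sum_congr rfl fun j _ => ?_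
  rw [Finset.sum_comm]
  refine Finset.sum_congr rfl fun i _ => ?_
  rw [virtualNode, Function.update_self]
  simp only [Finset.mul_sum]
  refine Finset.sum_congr rfl fun g _ => ?_
  have : (L.ξ ^ (g : ℕ)) ^ u = 1 := by
    rw [← pow_mul, mul_comm, pow_mul, L.primitive.pow_eq_one, one_pow]
  rw [mul_pow, pow_add (L.ξ ^ (g : ℕ)), pow_mul (L.ξ ^ (g : ℕ)), this, one_pow, pow_add, pow_mul]
  ring

/-- Contract the host's tensor coordinate with `rowVec`. On racks of the host's group this evaluates
the eigenvectors at the host's position; on other racks it commutes with their action and produces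
the messages. -/
theorem host_parity (L : RackLocators F nbar u s Γ) (j₀ : Fin nbar) (t m : ℕ)
    (c : Fin nbar × Fin u → (Γ → Fin s) → F) (hc : ∀ x, L.parity (t + u * m) x c = 0)
    (x : Γ → Fin s) :
    ∑ j, (if L.group j = L.group j₀ then
        ∑ i, (L.lam j i ^ u) ^ m * diffVec F (L.pos j) i (L.pos j₀) *
          L.virtualNode t j (fun g => c (j, g)) (Function.update x (L.group j₀) i)
      else ∑ i, (L.lam j i ^ u) ^ m * diffVec F (L.pos j) i (x (L.group j)).castSucc *
          L.message j₀ t j (fun g => c (j, g)) (Function.update x (L.group j) i)) = 0 := by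
  have h0 : ∑ a, rowVec F (L.pos j₀) a *
      L.parity (t + u * m) (Function.update x (L.group j₀) a) c = 0 := by
    simp [hc]
  rw [← h0]
  simp only [virtual_parity, Finset.mul_sum]
  rw [Finset.sum_comm]
  refine Finset.sum_congr rfl fun j _ => ?_
  rw [Finset.sum_comm]
  split_ifs with hj
  · refine Finset.sum_congr rfl fun i _ => ?_
    rw [← sum_rowVec_mul_diffVec, Finset.mul_sum, Finset.sum_mul]
    refine Finset.sum_congr rfl fun a _ => ?_
    rw [hj, Function.update_self, Function.update_idem]
    ring
  · refine Finset.sum_congr rfl fun i _ => ?_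
    rw [message, Finset.mul_sum]
    refine Finset.sum_congr rfl fun a _ => ?_
    rw [if_neg hj, Function.update_of_ne hj, Function.update_comm hj]
    ring

/-- If all messages sent by the racks of `H` vanish, so does the virtual node of the host rack. -/
theorem virtualNode_eq_zero (L : RackLocators F nbar u s Γ) (hs : 0 < s) (j₀ : Fin nbar) (t : ℕ)
    (H : Finset (Fin nbar)) (hj₀ : j₀ ∉ H) (c : Fin nbar × Fin u → (Γ → Fin s) → F)
    (hc : ∀ m < nbar - 1 - H.card + s, ∀ x, L.parity (t + u * m) x c = 0)
    (hmsg : ∀ j ∈ H, ∀ x, L.message j₀ t j (fun g => c (j, g)) x = 0) (x : Γ → Fin s) :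
    L.virtualNode t j₀ (fun g => c (j₀, g)) x = 0 := by
  classical
  have hidx : ∃ idx : Fin nbar → Fin s, ∀ j, L.group j = L.group j₀ → j ≠ j₀ →
      (L.pos j).succAbove (idx j) = L.pos j₀ := by
    have : ∀ j, ∃ i : Fin s, L.group j = L.group j₀ → j ≠ j₀ →
        (L.pos j).succAbove i = L.pos j₀ := by
      intro j
      by_cases hj : L.group j = L.group j₀ ∧ j ≠ j₀
      · obtain ⟨i, hi⟩ := Fin.exists_succAbove_eq (x := L.pos j₀) (y := L.pos j)
          (fun h => hj.2 (L.eq_of_group_pos _ _ hj.1 h.symm))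
        exact ⟨i, fun _ _ => hi⟩
      · exact ⟨⟨0, hs⟩, fun h1 h2 => absurd ⟨h1, h2⟩ hj⟩
    choose idx h using this
    exact ⟨idx, h⟩
  obtain ⟨idx, hidx⟩ := hidx
  set a₀ := L.group j₀ with ha₀
  have hdv : ∀ j, L.group j = a₀ → j ≠ j₀ → ∀ i,
      diffVec F (L.pos j) i (L.pos j₀) = if i = idx j then 1 else 0 := by
    intro j hja hjj₀ i
    rw [diffVec_of_ne fun h => hjj₀ (L.eq_of_group_pos _ _ hja h.symm)]
    refine if_congr ?_ rfl rfl
    rw [← hidx j hja hjj₀, Fin.succAbove_right_inj, eq_comm]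
  let U : Finset (Fin nbar) := (insert j₀ H)ᶜ
  have hU : U.card = nbar - 1 - H.card := by
    rw [Finset.card_compl, Fintype.card_fin, Finset.card_insert_of_notMem hj₀]
    omega
  -- The unknowns are the messages of the silent racks and the `s` slices of the host's virtual
  -- node. In the host's group every unknown has a scalar eigenvalue: `idx j` selects the only
  -- visible one of rack `j`, and slice `k` has `λ_{j₀,k} ^ u`. The slices enter `d` negated because
  -- of `diffVec_self`.
  let T : Finset (Fin nbar ⊕ Fin s) := U.disjSum Finset.univ
  have hTcard : T.card = nbar - 1 - H.card + s := by
    rw [Finset.card_disjSum, hU, Finset.card_univ, Fintype.card_fin]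
  let γ : Fin nbar ⊕ Fin s → Γ := Sum.elim L.group fun _ => a₀
  let κ : Fin nbar ⊕ Fin s → Fin s → F := Sum.elim
    (fun j i => if L.group j = a₀ then L.lam j (idx j) ^ u else L.lam j i ^ u)
    fun k _ => L.lam j₀ k ^ u
  let w : Fin nbar ⊕ Fin s → Fin s → Fin s → F := Sum.elim
    (fun j i r => if L.group j = a₀ then (if i = r then 1 else 0)
      else diffVec F (L.pos j) i r.castSucc)
    fun _ i r => if i = r then 1 else 0
  let d : Fin nbar ⊕ Fin s → (Γ → Fin s) → F := Sum.elim
    (fun j => L.message j₀ t j fun g => c (j, g))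
    fun k x => - L.virtualNode t j₀ (fun g => c (j₀, g)) (Function.update x a₀ k)
  have key := tensor_blockVandermonde_injective γ κ w ?_ T ?_ d ?_ (Sum.inr (x a₀))
    (by simp [T])
  · have := congrFun key x
    simpa [d] using this
  · have hne : ∀ j j' i i', L.group j ≠ L.group j' → L.lam j i ^ u ≠ L.lam j' i' ^ u :=
      fun j j' i i' h h' => h (by rw [(L.lam_pow_injective _ _ _ _ h').1])
    rintro (j | k) (j' | k') i i' h
    · simp only [κ, Sum.elim_inl]
      split_ifs <;> exact hne _ _ _ _ h
    · simp only [κ, Sum.elim_inl, Sum.elim_inr]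
      split_ifs <;> exact hne _ _ _ _ h
    · simp only [κ, Sum.elim_inl, Sum.elim_inr]
      split_ifs <;> exact hne _ _ _ _ h
    · exact absurd rfl h
  · intro a
    by_cases ha : a = a₀
    · refine BlockVandermondeInjective.of_scalar _ _ _
        (Sum.elim (fun j => L.lam j (idx j) ^ u) fun k => L.lam j₀ k ^ u) ?_ ?_ ?_
      · rintro (j | k) hν i
        · have : L.group j = a₀ := ha ▸ (Finset.mem_filter.1 hν).2
          simp [κ, this]
        · rfl
      · have hnot : ∀ j, Sum.inl j ∈ T.filter (γ · = a) → j ≠ j₀ := by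
          rintro j hj rfl
          simp [T, U] at hj
        rintro (j | k) hν (j' | k') hν' h
        · rw [(L.lam_pow_injective _ _ _ _ h).1]
        · exact absurd (L.lam_pow_injective _ _ _ _ h).1 (hnot j hν)
        · exact absurd (L.lam_pow_injective _ _ _ _ h).1.symm (hnot j' hν')
        · rw [(L.lam_pow_injective _ _ _ _ h).2]
      · rintro (j | k) hν y hy
        · have : L.group j = a₀ := ha ▸ (Finset.mem_filter.1 hν).2
          funext r
          simpa [w, this] using hy r
        · funext r
          simpa [w] using hy r
    · have hfilter : T.filter (γ · = a)
          = (U.filter (L.group · = a)).map Function.Embedding.inl := by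
        ext (j | k)
        · simp [T, γ]
        · simp [γ, Ne.symm ha]
      rw [hfilter]
      refine BlockVandermondeInjective.map _ _ _ _ ?_
      refine (L.rack_locally_injective (U.filter (L.group · = a)) ?_).congr ?_ ?_
      · intro j hj j' hj'
        rw [(Finset.mem_filter.1 hj).2, (Finset.mem_filter.1 hj').2]
      · intro j hj
        have : L.group j ≠ a₀ := (Finset.mem_filter.1 hj).2 ▸ ha
        funext i
        simp [κ, this]
      · intro j hj
        have : L.group j ≠ a₀ := (Finset.mem_filter.1 hj).2 ▸ ha
        funext i r
        simp [w, this]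
  · intro m hm x
    rw [hTcard] at hm
    have h1 := L.host_parity j₀ t m c (hc m hm) x
    rw [← h1, Finset.sum_disjSum, ← Finset.sum_compl_add_sum (insert j₀ H),
      Finset.sum_insert hj₀]
    rw [Finset.sum_eq_zero (s := H), add_zero]
    · congr 1
      · refine Finset.sum_congr rfl fun j hj => ?_
        have hjj₀ : j ≠ j₀ := by
          rintro rfl
          simp at hj
        by_cases hja : L.group j = a₀
        · rw [if_pos hja]
          simp only [κ, w, d, γ, Sum.elim_inl, hja, if_true, message]
          simp [hdv j hja hjj₀, ← ha₀]
        · rw [if_neg hja]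
          simp only [κ, w, d, γ, Sum.elim_inl, hja, if_false]
      · rw [if_pos rfl]
        refine Finset.sum_congr rfl fun k _ => ?_
        simp [κ, w, d, γ, diffVec_self, ← ha₀]
    · intro j hj
      by_cases hja : L.group j = a₀
      · rw [if_pos hja]
        have hjj₀ : j ≠ j₀ := fun h => hj₀ (h ▸ hj)
        have h2 := hmsg j hj x
        simp only [message, hja, ← ha₀, if_true] at h2
        simp only [hdv j hja hjj₀, ite_mul, one_mul, zero_mul, Finset.sum_ite_eq', Finset.mem_univ,
          if_true] at h2
        simp [hdv j hja hjj₀, ← ha₀, h2]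
      · rw [if_neg hja]
        simp [hmsg j hj]

end RackLocators

/-! ### The code, its MDS property and its repair schemes. -/

namespace RackLocators

variable {F : Type*} [Field F] {nbar u s l : ℕ} {Γ : Type*} [DecidableEq Γ]

/-- The array codeword as a function of the racks, the nodes and the tensor coordinates. -/
def unfoldNodes (φ : Fin l ≃ (Γ → Fin s)) (c : Fin (nbar * u) → Fin l → F) :
    Fin nbar × Fin u → (Γ → Fin s) → F :=
  fun ν x => c (rackNode ν.1 ν.2) (φ.symm x)

/-- The first `r` blocks of parity checks. -/
def parityMap (L : RackLocators F nbar u s Γ) (φ : Fin l ≃ (Γ → Fin s)) (r : ℕ) :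
    (Fin (nbar * u) → Fin l → F) →ₗ[F] (Fin r × Fin l → F) where
  toFun c p := L.parity p.1 (φ p.2) (unfoldNodes φ c)
  map_add' c c' := by
    funext p
    simp [parity, unfoldNodes, mul_add, Finset.sum_add_distrib]
  map_smul' a c := by
    funext p
    simp only [parity, unfoldNodes, Pi.smul_apply, smul_eq_mul, RingHom.id_apply, Finset.mul_sum]
    refine Finset.sum_congr rfl fun _ _ => Finset.sum_congr rfl fun _ _ => ?_
    ring

/-- The rack-aware array code with `r` parity nodes. -/
def code (L : RackLocators F nbar u s Γ) (φ : Fin l ≃ (Γ → Fin s)) (r : ℕ) :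
    Submodule F (Fin (nbar * u) → Fin l → F) :=
  LinearMap.ker (L.parityMap φ r)

theorem parity_eq_zero_of_mem (L : RackLocators F nbar u s Γ) (φ : Fin l ≃ (Γ → Fin s)) {r : ℕ}
    {c : Fin (nbar * u) → Fin l → F} (hc : c ∈ L.code φ r) {m : ℕ} (hm : m < r) (x : Γ → Fin s) :
    L.parity m x (unfoldNodes φ c) = 0 := by
  have := congrFun (LinearMap.mem_ker.1 hc) (⟨m, hm⟩, φ.symm x)
  simpa [parityMap] using this

theorem eq_zero_of_mem_code (L : RackLocators F nbar u s Γ) (φ : Fin l ≃ (Γ → Fin s)) {r k : ℕ}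
    (hrk : r + k = nbar * u) (S : Finset (Fin (nbar * u))) (hS : S.card = k)
    (c : Fin (nbar * u) → Fin l → F) (hc : c ∈ L.code φ r) (hcS : ∀ i ∈ S, c i = 0) : c = 0 := by
  have hT : (Sᶜ.map finProdFinEquiv.symm.toEmbedding : Finset (Fin nbar × Fin u)).card = r := by
    rw [Finset.card_map, Finset.card_compl, Fintype.card_fin, hS]
    omega
  have h0 := L.eq_zero_of_parity (Sᶜ.map finProdFinEquiv.symm.toEmbedding) (unfoldNodes φ c)
    (fun ν hν => ?_) (fun m hm x => L.parity_eq_zero_of_mem φ hc (hT ▸ hm) x)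
  · funext k p
    have h1 := congrFun (congrFun h0 (finProdFinEquiv.symm k)) (φ p)
    rw [unfoldNodes, rackNode, Prod.mk.eta, Equiv.apply_symm_apply, Equiv.symm_apply_apply] at h1
    exact h1
  · have : rackNode ν.1 ν.2 ∈ S := by
      by_contra hn
      refine hν (Finset.mem_map.2 ⟨rackNode ν.1 ν.2, Finset.mem_compl.2 hn, ?_⟩)
      exact finProdFinEquiv.symm_apply_apply ν
    funext x
    simp [unfoldNodes, hcS _ this]

/-- Any `k` coordinates determine a codeword, which bounds the dimension above; counting the `r * l`
parity checks bounds it below. -/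
theorem isMDSArrayCode (L : RackLocators F nbar u s Γ) (φ : Fin l ≃ (Γ → Fin s)) {r k : ℕ}
    (hrk : r + k = nbar * u) : IsMDSArrayCode (L.code φ r) k := by
  refine ⟨le_antisymm ?_ ?_, fun S hS c hc c' hc' h => ?_⟩
  · obtain ⟨S, -, hS⟩ := Finset.exists_subset_card_eq
      (s := (Finset.univ : Finset (Fin (nbar * u)))) (n := k) (by simp; omega)
    let f : L.code φ r →ₗ[F] (S → Fin l → F) :=
      (LinearMap.funLeft F (Fin l → F) (Subtype.val : S → Fin (nbar * u))) ∘ₗ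
        (L.code φ r).subtype
    have hf : Function.Injective f := by
      rw [injective_iff_map_eq_zero]
      intro c hc
      refine Subtype.ext (L.eq_zero_of_mem_code φ hrk S hS c c.2 fun i hi => ?_)
      exact congrFun hc ⟨i, hi⟩
    have := LinearMap.finrank_le_finrank_of_injective hf
    simpa [Module.finrank_pi_fintype, hS] using this
  · have h1 := LinearMap.finrank_range_add_finrank_ker (L.parityMap φ r)
    have h2 := Submodule.finrank_le (LinearMap.range (L.parityMap φ r))
    have h3 : Module.finrank F (Fin (nbar * u) → Fin l → F) = r * l + k * l := by
      rw [← add_mul, hrk]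
      simp [Module.finrank_pi_fintype]
    have h4 : Module.finrank F (Fin r × Fin l → F) = r * l := by simp
    rw [h3] at h1
    rw [h4] at h2
    rw [code]
    omega
  · refine sub_eq_zero.1 (L.eq_zero_of_mem_code φ hrk S hS _ (Submodule.sub_mem _ hc hc')
      fun i hi => ?_)
    simp [h i hi]

theorem message_sub (L : RackLocators F nbar u s Γ) (j₀ : Fin nbar) (t : ℕ) (j : Fin nbar)
    (X Y : Fin u → (Γ → Fin s) → F) (x : Γ → Fin s) :
    L.message j₀ t j (fun g y => X g y - Y g y) x
      = L.message j₀ t j X x - L.message j₀ t j Y x := by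
  simp only [message, virtualNode, mul_sub, Finset.sum_sub_distrib]

/-- The host's coordinate has been summed out, so a message consists of only `s ^ (G - 1)` symbols
for `G` groups. -/
theorem message_update (L : RackLocators F nbar u s Γ) (j₀ : Fin nbar) (t : ℕ) (j : Fin nbar)
    (X : Fin u → (Γ → Fin s) → F) (x : Γ → Fin s) (i : Fin s) :
    L.message j₀ t j X (Function.update x (L.group j₀) i) = L.message j₀ t j X x := by
  simp [message]

/-- The failed nodes are determined by the surviving nodes of the host rack and by the messages of
sufficiently many helper racks for each of the exponents `t < |I|`. -/
theorem failed_nodes_unique (L : RackLocators F nbar u s Γ) (hs : 0 < s)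
    (φ : Fin l ≃ (Γ → Fin s)) {r : ℕ} (i : Fin nbar) (I : Finset (Fin u)) (H : Finset (Fin nbar))
    (hi : i ∉ H) (E : Fin nbar → Finset ℕ)
    (hE : ∀ t < I.card, ∀ m < nbar - 1 - (H.filter (t ∈ E ·)).card + s, t + u * m < r)
    (c c' : Fin (nbar * u) → Fin l → F) (hc : c ∈ L.code φ r) (hc' : c' ∈ L.code φ r)
    (hmsg : ∀ j ∈ H, ∀ t ∈ E j, ∀ x,
      L.message i t j (fun g => unfoldNodes φ c (j, g)) x
        = L.message i t j (fun g => unfoldNodes φ c' (j, g)) x)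
    (hsurv : ∀ g ∉ I, c (rackNode i g) = c' (rackNode i g)) :
    ∀ g ∈ I, c (rackNode i g) = c' (rackNode i g) := by
  have hd : c - c' ∈ L.code φ r := Submodule.sub_mem _ hc hc'
  have hv : ∀ t < I.card, ∀ x,
      ∑ g ∈ I, (L.ξ ^ (g : ℕ)) ^ t * unfoldNodes φ (c - c') (i, g) x = 0 := by
    intro t ht x
    have h1 := L.virtualNode_eq_zero hs i t (H.filter (t ∈ E ·))
      (fun h => hi (Finset.mem_filter.1 h).1) (unfoldNodes φ (c - c'))
      (fun m hm x => L.parity_eq_zero_of_mem φ hd (hE t ht m hm) x) (fun j hj x => ?_) x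
    · rw [virtualNode] at h1
      have h2 := (mul_eq_zero.1 h1).resolve_left (pow_ne_zero _ (L.lam_ne_zero _ _))
      rw [← h2]
      refine Finset.sum_subset (Finset.subset_univ _) fun g _ hg => ?_
      simp [unfoldNodes, hsurv g hg]
    · obtain ⟨hjH, hjt⟩ := Finset.mem_filter.1 hj
      have h1 := L.message_sub i t j (fun g => unfoldNodes φ c (j, g))
        (fun g => unfoldNodes φ c' (j, g)) x
      rw [hmsg j hjH t hjt x, sub_self] at h1
      exact h1
  intro g hg
  funext p
  have h1 := vandermonde_finset_injective I (fun g => L.ξ ^ (g : ℕ)) ?_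
    (fun g => unfoldNodes φ (c - c') (i, g) (φ p)) (fun t ht => hv t ht (φ p)) g hg
  · simpa [unfoldNodes, sub_eq_zero] using h1
  · intro g _ g' _ h
    exact Fin.ext (L.primitive.pow_inj g.2 g'.2 h)

/-- `E j` holds the exponents for which rack `j` sends its message, and `hE` provides enough parity
checks for each exponent. Recovery reads the failed nodes off any codeword consistent with the data;
`failed_nodes_unique` makes the choice irrelevant. -/
theorem exists_rackRepairScheme [Fintype Γ] (L : RackLocators F nbar u s Γ) (hs : 0 < s)
    (φ : Fin l ≃ (Γ → Fin s)) {r : ℕ} (i : Fin nbar) (I : Finset (Fin u)) (H : Finset (Fin nbar))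
    (hi : i ∉ H) (E : Fin nbar → Finset ℕ)
    (hE : ∀ t < I.card, ∀ m < nbar - 1 - (H.filter (t ∈ E ·)).card + s, t + u * m < r) :
    ∃ R : RackRepairScheme (L.code φ r) i I H,
      ∀ j, R.β j = (E j).card * s ^ (Fintype.card Γ - 1) := by
  classical
  have hcard : ∀ j, Fintype.card (E j × ({a : Γ // a ≠ L.group i} → Fin s))
      = (E j).card * s ^ (Fintype.card Γ - 1) := by
    intro j
    simp [Fintype.card_subtype_compl]
  let e : ∀ j, E j × ({a : Γ // a ≠ L.group i} → Fin s)
      ≃ Fin ((E j).card * s ^ (Fintype.card Γ - 1)) := fun j => Fintype.equivFinOfCardEq (hcard j)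
  -- The filler `0` at the host's coordinate is harmless by `message_update`.
  let ext : ({a : Γ // a ≠ L.group i} → Fin s) → Γ → Fin s := fun y a =>
    if h : a ≠ L.group i then y ⟨a, h⟩ else ⟨0, hs⟩
  let send : ∀ j : {j // j ∈ H}, (Fin u → Fin l → F) →
      (Fin ((E j).card * s ^ (Fintype.card Γ - 1)) → F) := fun j X q =>
    L.message i ((e j).symm q).1 j (fun g x => X g (φ.symm x)) (ext ((e j).symm q).2)
  let P : (∀ j : {j : Fin nbar // j ∈ H}, Fin ((E j).card * s ^ (Fintype.card Γ - 1)) → F) →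
      ({g : Fin u // g ∉ I} → Fin l → F) → (Fin (nbar * u) → Fin l → F) → Prop :=
    fun data surv c => c ∈ L.code φ r ∧ (fun j => send j fun g => c (rackNode j.1 g)) = data ∧
      (fun g : {g : Fin u // g ∉ I} => c (rackNode i g.1)) = surv
  refine ⟨⟨fun j => (E j).card * s ^ (Fintype.card Γ - 1), send, fun data surv g =>
    if h : ∃ c, P data surv c then h.choose (rackNode i g.1) else 0, fun c hc => ?_⟩, fun _ => rfl⟩
  have hex : ∃ c', P (fun j => send j fun g => c (rackNode j.1 g))
      (fun g => c (rackNode i g.1)) c' := ⟨c, hc, rfl, rfl⟩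
  funext g
  rw [dif_pos hex]
  obtain ⟨h1, h2, h3⟩ := hex.choose_spec
  refine L.failed_nodes_unique hs φ i I H hi E hE _ _ h1 hc (fun j hj t ht x => ?_)
    (fun g hg => congrFun h3 ⟨g, hg⟩) g g.2
  have h4 := congrFun (congrFun h2 ⟨j, hj⟩) (e j (⟨t, ht⟩, fun a => x a))
  simp only [send, Equiv.symm_apply_apply] at h4
  have hx : Function.update (ext fun a => x a) (L.group i) (x (L.group i)) = x := by
    funext a
    by_cases ha : a = L.group i
    · subst ha; simp
    · simp [ext, ha]
  rw [← L.message_update i t j _ (ext fun a => x a) (x (L.group i)),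
    ← L.message_update i t j _ (ext fun a => x a) (x (L.group i)), hx] at h4
  exact h4

end RackLocators

/-! ### Choice of parameters and the main theorem. -/

/-- Locators for racks grouped consecutively in groups of `s + 1`. -/
theorem exists_rackLocators {F : Type*} [Field F] [Fintype F] {nbar u s G : ℕ} (hu : 1 ≤ u)
    (hG : nbar ≤ G * (s + 1)) (hdvd : u ∣ Fintype.card F - 1)
    (hq : ((nbar * s : ℕ) : ℚ) * u + u * Omega (s + 1) u + 1 ≤ Fintype.card F) :
    Nonempty (RackLocators F nbar u s (Fin G)) := by
  classical
  obtain ⟨ξ, hξ⟩ : ∃ ξ : F, IsPrimitiveRoot ξ u := by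
    obtain ⟨g, hg⟩ := IsCyclic.exists_ofOrder_eq_natCard (α := Fˣ)
    rw [Nat.card_eq_fintype_card, Fintype.card_units] at hg
    obtain ⟨k, hk⟩ := hdvd
    have hpos : 0 < Fintype.card F - 1 := Nat.sub_pos_of_lt Fintype.one_lt_card
    have h1 := (hg ▸ IsPrimitiveRoot.orderOf g).pow hpos (hk.trans (mul_comm _ _))
    exact ⟨_, h1.map_of_injective (f := Units.coeHom F) Units.val_injective⟩
  let group : Fin nbar → Fin G := fun j =>
    ⟨j / (s + 1), (Nat.div_lt_iff_lt_mul (Nat.succ_pos _)).2 (j.2.trans_le hG)⟩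
  let pos : Fin nbar → Fin (s + 1) := fun j => ⟨j % (s + 1), Nat.mod_lt _ (Nat.succ_pos _)⟩
  have hinj : ∀ j j', group j = group j' → pos j = pos j' → j = j' := by
    intro j j' h1 h2
    simp only [group, pos, Fin.mk.injEq] at h1 h2
    exact Fin.ext (by rw [← Nat.div_add_mod j (s + 1), h1, h2, Nat.div_add_mod])
  have hgroup : ∀ a, (Finset.univ.filter (group · = a)).card ≤ s + 1 := by
    intro a
    have := Finset.card_le_card_of_injOn (s := Finset.univ.filter (group · = a))
      (t := (Finset.univ : Finset (Fin (s + 1)))) pos (fun _ _ => Finset.mem_univ _)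
      (fun j hj j' hj' h => hinj j j' (by
        rw [(Finset.mem_filter.1 hj).2, (Finset.mem_filter.1 hj').2]) h)
    simpa using this
  obtain ⟨lam, h1, h2, h3⟩ := exists_eigenvalues hu group pos hgroup
    (fun g : Fin u => ξ ^ (g : ℕ)) (fun g g' h => Fin.ext (hξ.pow_inj g.2 g'.2 h))
    (fun g => pow_ne_zero _ (hξ.ne_zero (by omega))) (by simpa using hq)
  exact ⟨⟨group, pos, ξ, lam, hinj, hξ, h1, h2, h3⟩⟩

theorem theorem2 {F : Type*} [Field F] [Fintype F]
    (nbar kbar dbar u v sbar l : ℕ)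
    (hkbar : 1 ≤ kbar)
    (hv : v < u)
    (hd_lower : kbar + 1 ≤ dbar) (hd_upper : dbar ≤ nbar - 1)
    (hsbar : sbar = dbar - kbar + 1)
    (hl : l = sbar ^ ⌈(nbar : ℚ) / ((sbar : ℚ) + 1)⌉₊)
    (hu_dvd : u ∣ Fintype.card F - 1)
    (hq : ((nbar * u : ℕ) : ℚ) * (sbar : ℚ)
        + (u : ℚ) * (Omega (sbar + 1) u + (sbar : ℚ) * 2 ^ (sbar - 1))
      ≤ (Fintype.card F : ℚ)) :
    ∃ C : Submodule F (Fin (nbar * u) → Fin l → F),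
      IsMDSArrayCode C (kbar * u + v) ∧
      -- optimal repair of `1 ≤ h ≤ u - v` failed nodes of any rack from any `dbar` helper racks
      (∀ h : ℕ, 1 ≤ h → h ≤ u - v →
        ∀ (i : Fin nbar) (I : Finset (Fin u)), I.card = h →
        ∀ H : Finset (Fin nbar), i ∉ H → H.card = dbar →
          ∃ R : RackRepairScheme C i I H,
            (∀ j ∈ H, (R.β j : ℚ) = (h : ℚ) * (l : ℚ) / (sbar : ℚ)) ∧
            (R.bandwidth : ℚ) = cutSetBound dbar h l sbar) ∧
      -- asymptotically optimal repair of `u - v + 1 ≤ h ≤ u` failed nodes of any rack from any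
      -- `dbar` helper racks and any one further rack
      (∀ h : ℕ, u - v + 1 ≤ h → h ≤ u →
        ∀ (i : Fin nbar) (I : Finset (Fin u)), I.card = h →
        ∀ H : Finset (Fin nbar), i ∉ H → H.card = dbar →
        ∀ j' : Fin nbar, j' ≠ i → j' ∉ H →
          ∃ R : RackRepairScheme C i I (insert j' H),
            (∀ j ∈ H, (R.β j : ℚ) = (h : ℚ) * (l : ℚ) / (sbar : ℚ)) ∧
            (R.bandwidth : ℚ) = cutSetBound dbar h l sbar
              + ((h : ℚ) - (u : ℚ) + (v : ℚ)) * (l : ℚ) / (sbar : ℚ) ∧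
            (R.bandwidth : ℚ) < (1 + 1 / (dbar : ℚ)) * cutSetBound dbar h l sbar) := by
  subst hsbar
  set s := dbar - kbar + 1 with hs
  set G := ⌈(nbar : ℚ) / ((s : ℚ) + 1)⌉₊ with hGdef
  have hs0 : 0 < s := Nat.succ_pos _
  have hu : 1 ≤ u := by omega
  have hG : nbar ≤ G * (s + 1) := by
    have h1 := Nat.le_ceil ((nbar : ℚ) / ((s : ℚ) + 1))
    rw [div_le_iff₀ (by positivity)] at h1
    have h2 : (nbar : ℚ) ≤ ((G * (s + 1) : ℕ) : ℚ) := by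
      rw [Nat.cast_mul, Nat.cast_add, Nat.cast_one]
      exact h1
    exact Nat.cast_le.1 h2
  have hG1 : 1 ≤ G := by
    by_contra h
    have : G = 0 := by omega
    rw [this] at hG
    omega
  have hlG : l = s * s ^ (G - 1) := by
    rw [hl, ← pow_succ', Nat.sub_add_cancel hG1]
  have hsQ : (s : ℚ) ≠ 0 := by exact_mod_cast hs0.ne'
  -- Of the summand `u * s * 2 ^ (s - 1)` in the field-size bound only one unit is needed, to make
  -- the degree inequality strict.
  obtain ⟨L⟩ := exists_rackLocators (F := F) (nbar := nbar) (s := s) hu hG hu_dvd (by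
    have h1 : (1 : ℚ) ≤ u * (s * 2 ^ (s - 1)) := by
      exact_mod_cast Nat.one_le_iff_ne_zero.2 (by positivity)
    push_cast at hq ⊢
    linarith)
  let φ : Fin l ≃ (Fin G → Fin s) := (finCongr hl).trans finFunctionFinEquiv.symm
  have hkn : (nbar - kbar - 1) * u + (u - v) + (kbar * u + v) = nbar * u := by
    obtain ⟨d, hd⟩ : ∃ d, nbar = kbar + 1 + d := ⟨nbar - (kbar + 1), by omega⟩
    have h1 : nbar - kbar - 1 = d := by omega
    rw [h1, hd]
    have : u - v + v = u := by omega
    linarith [add_mul (kbar + 1) d u, add_mul kbar 1 u]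
  -- This is `n - k`. The exponents `t + u * m < r` allow `nbar - kbar` values of `m` if `t < u -
  -- v`, and one fewer if `u - v ≤ t < u`.
  set r := (nbar - kbar - 1) * u + (u - v) with hr
  have hβ : ∀ h : ℕ, ((h * s ^ (G - 1) : ℕ) : ℚ) = h * l / s := by
    intro h
    rw [hlG, eq_div_iff hsQ]
    push_cast
    ring
  refine ⟨L.code φ r, L.isMDSArrayCode φ hkn, ?_, ?_⟩
  · intro h _ hh i I hI H hi hH
    obtain ⟨R, hR⟩ := L.exists_rackRepairScheme hs0 φ (r := r) i I H hi
      (fun _ => Finset.range h) (fun t ht m hm => by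
        rw [hI] at ht
        rw [Finset.filter_true_of_mem fun _ _ => Finset.mem_range.2 ht, hH] at hm
        have h1 : u * m ≤ (nbar - kbar - 1) * u := by
          rw [mul_comm]
          exact Nat.mul_le_mul_right _ (by omega)
        omega)
    simp only [Finset.card_range, Fintype.card_fin] at hR
    have hRβ : ∀ j ∈ H, (R.β j : ℚ) = (h : ℚ) * (l : ℚ) / (s : ℚ) := fun j _ => by
      rw [hR j, hβ]
    refine ⟨R, hRβ, ?_⟩
    rw [RackRepairScheme.bandwidth, Nat.cast_sum, Finset.sum_congr rfl hRβ, Finset.sum_const, hH,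
      cutSetBound, nsmul_eq_mul]
    ring
  · intro h hh hhu i I hI H hi hH j' hj'i hj'H
    -- The further rack helps only with the exponents `t ≥ u - v`, which lack one parity check; this
    -- costs `h - (u - v)` messages.
    let E : Fin nbar → Finset ℕ := fun j =>
      if j = j' then Finset.Ico (u - v) h else Finset.range h
    -- Ensures that `nbar - 1 - (dbar + 1)` is not truncated, so the extra helper really removes one
    -- unknown.
    have hcardH : H.card + 2 ≤ nbar := by
      have h1 := Finset.card_le_univ (insert i (insert j' H))
      rw [Finset.card_insert_of_notMem, Finset.card_insert_of_notMem hj'H, Fintype.card_fin] at h1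
      · exact h1
      · simp [hi, hj'i.symm]
    obtain ⟨R, hR⟩ := L.exists_rackRepairScheme hs0 φ (r := r) i I (insert j' H)
      (by simp [hi, hj'i.symm]) E (fun t ht m hm => by
        rw [hI] at ht
        have hH' : ∀ j ∈ H, t ∈ E j := by
          intro j hj
          have : j ≠ j' := fun h => hj'H (h ▸ hj)
          simp [E, this, ht]
        rw [Finset.filter_insert, Finset.filter_true_of_mem hH'] at hm
        by_cases htv : u - v ≤ t
        · rw [if_pos (by simp [E, htv, ht]), Finset.card_insert_of_notMem hj'H, hH] at hm
          have h1 : u * (m + 1) ≤ (nbar - kbar - 1) * u := by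
            rw [mul_comm]
            exact Nat.mul_le_mul_right _ (by omega)
          rw [mul_add, mul_one] at h1
          omega
        · rw [if_neg (by simp [E, htv]), hH] at hm
          have h1 : u * m ≤ (nbar - kbar - 1) * u := by
            rw [mul_comm]
            exact Nat.mul_le_mul_right _ (by omega)
          omega)
    simp only [Fintype.card_fin] at hR
    have hRβ : ∀ j ∈ H, (R.β j : ℚ) = (h : ℚ) * (l : ℚ) / (s : ℚ) := fun j hj => by
      have : j ≠ j' := fun h => hj'H (h ▸ hj)
      rw [hR j, hβ]
      simp [E, this]
    have hRj' : (R.β j' : ℚ) = ((h : ℚ) - u + v) * l / s := by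
      rw [hR j', hβ]
      simp only [E, if_true, Nat.card_Ico]
      rw [Nat.cast_sub (by omega), Nat.cast_sub hv.le]
      ring
    have hbw : (R.bandwidth : ℚ) = cutSetBound dbar h l s
        + ((h : ℚ) - (u : ℚ) + (v : ℚ)) * (l : ℚ) / (s : ℚ) := by
      rw [RackRepairScheme.bandwidth, Nat.cast_sum, Finset.sum_insert hj'H,
        Finset.sum_congr rfl hRβ, Finset.sum_const, hH, hRj', cutSetBound, nsmul_eq_mul]
      ring
    refine ⟨R, hRβ, hbw, ?_⟩
    have hd0 : (dbar : ℚ) ≠ 0 := by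
      have : dbar ≠ 0 := by omega
      exact_mod_cast this
    have hlpos : (0 : ℚ) < l / s := by
      have : 0 < l := by rw [hl]; positivity
      have hspos : (0 : ℚ) < s := by exact_mod_cast hs0
      positivity
    have hvu : (v : ℚ) < u := by exact_mod_cast hv
    -- The allowed excess is `h * l / s`, and the actual one is smaller since `v < u`.
    have h1 : (1 + 1 / (dbar : ℚ)) * cutSetBound dbar h l s
        = cutSetBound dbar h l s + h * (l / s) := by
      rw [cutSetBound]
      field_simp
    rw [hbw, h1, mul_div_assoc]
    have : ((h : ℚ) - u + v) < h := by linarith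
    gcongr
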